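/- **Conventions.** A *(finite) ringed poset* is a finite poset $X$ with a functor $x\mapsto\mathcal O_{X,x}$ from $X$ to commutative rings; open subsets are the upward closed ones, $U_x=\{x'\ge x\}$, and $\mathcal O_X(U)=\lim_{x\in U}\mathcal O_{X,x}$. A *morphism* $f\colon X\to Y$ is a monotone map together with a natural family of ring maps $f^\sharp_x\colon\mathcal O_{Y,f(x)}\to\mathcal O_{X,x}$. The *fibered product* $X\times_S Y$ is the fibered product of posets with $\mathcal O_{(x,y)}=\mathcal O_{X,x}\otimes_{\mathcal O_{S,s}}\mathcal O_{Y,y}$, where $s$ is the common image of $x$ and $y$. * $X$ is *schematic* if $\mathcal O_{X,x}\to\mathcal O_{X,y}$ is flat for all $x\le y$, and for all $t\le x,y$ the map $\mathcal O_{X,x}\otimes_{\mathcal O_{X,t}}\mathcal O_{X,y}\to\prod_{z\ge x,y}\mathcal O_{X,z}$ is faithfully flat. A morphism $f\colon X\to Y$ of schematic spaces is *schematic* if for all $x\in X$ and $y\ge f(x)$ the map $\mathcal O_{X,x}\otimes_{\mathcal O_{Y,f(x)}}\mathcal O_{Y,y}\to\prod_{z\in U_x\cap f^{-1}(U_y)}\mathcal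 O_{X,z}$ is surjective on prime spectra. $\mathbf{SchFin}$ is the category of schematic spaces and schematic morphisms. * An $\mathcal O_X$-module $N$ is *quasi-coherent* if $N_x\otimes_{\mathcal O_{X,x}}\mathcal O_{X,y}\to N_y$ is an isomorphism for all $x\le y$. $X$ is *$\mathbf{Mod}$-affine* if, for the projection $\pi\colon X\to(\star,\mathcal O_X(X))$, the adjunction $\pi^*\dashv\pi_*$ between quasi-coherent $\mathcal O_X$-modules and $\mathcal O_X(X)$-modules is an adjoint equivalence. * A morphism $f\colon X\to Y$ is a *qc-isomorphism* if $f^{-1}(U_y)$ is $\mathbf{Mod}$-affine for all $y\in Y$ and $\mathcal O_Y\to f_*\mathcal O_X$ is an isomorphism. A schematic morphism $f\colon X\to Y$ is a *flat immersion* if all $f^\sharp_x$ are flat and its diagonal $X\to X\times_YX$ is a qc-isomorphism. * A *$\mathbf{SchFin}^{\mathrm{op}}$-datum* $\mathcal X$ is a finite poset $|\mathcal X|$ with a functor $|\mathcal X|\to\mathbf{SchFin}^{\mathrm{op}}$; that is, schematic spaces $\mathcal X(p)$ and, functorially for $p\le q$, schematic restriction morphisms $\mathcal X_{pq}\colon\mathcal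 X(q)\to\mathcal X(p)$. Its *cylinder* $\mathrm{Cyl}(\mathcal X)$ is the ringed poset with underlying set $\coprod_p|\mathcal X(p)|$, order $x_p\le y_q$ iff $p\le q$ and $x_p\le\mathcal X_{pq}(y_q)$, stalks $\mathcal O_{\mathcal X(p),x_p}$ at $x_p$, and restriction maps $\mathcal O_{\mathcal X(p),x_p}\to\mathcal O_{\mathcal X(p),\mathcal X_{pq}(y_q)}\to\mathcal O_{\mathcal X(q),y_q}$. For $U\subseteq|\mathcal X|$ open, $\mathrm{Cyl}(U)$ is the cylinder of the datum induced on $U$. For $t\le p,q$, the maps $\mathcal X_{pr}$ and $\mathcal X_{qr}$ ($r\ge p,q$) induce a natural morphism $$\pi^t_{pq}\colon\mathrm{Cyl}(U_p\cap U_q)\to\mathcal X(p)\times_{\mathcal X(t)}\mathcal X(q).$$ **Theorem.** Let $\mathcal X$ be a $\mathbf{SchFin}^{\mathrm{op}}$-datum whose restriction morphisms are flat immersions. Then $\mathrm{Cyl}(\mathcal X)$ is schematic if and only if $\pi^t_{pq}$ is a qc-isomorphism of ringed posets for all $t\le p,q$ in $|\mathcal X|$. Moreover, if $\mathrm{Cyl}(\mathcal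 X)$ is schematic, then for all $t\le p,q$ the ringed posets $\mathrm{Cyl}(U_p\cap U_q)$ and $\mathcal X(p)\times_{\mathcal X(t)}\mathcal X(q)$ are schematic and $\pi^t_{pq}$ is a schematic morphism, so that $\pi^t_{pq}$ is a qc-isomorphism of schematic spaces. -/

import Mathlib

universe u

set_option linter.style.haveILetI false

noncomputable section

/-! ### Tensor products along ring homomorphisms -/

section Tens

variable {R A B C : Type u} [CommRing R] [CommRing A] [CommRing B] [CommRing C]

/-- The tensor product `A ⊗_R B` of the `R`-algebras given by ring homomorphisms
`f : R → A` and `g : R → B`. -/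
def Tens (f : R →+* A) (g : R →+* B) : Type u :=
  @TensorProduct R _ A B _ _ f.toAlgebra.toModule g.toAlgebra.toModule

namespace Tens

variable (f : R →+* A) (g : R →+* B)

instance : CommRing (Tens f g) :=
  @Algebra.TensorProduct.instCommRing R A B _ _ f.toAlgebra _ g.toAlgebra

/-- `a ↦ a ⊗ 1`. -/
def inl : A →+* Tens f g :=
  letI := f.toAlgebra
  letI := g.toAlgebra
  (Algebra.TensorProduct.includeLeftRingHom : A →+* TensorProduct R A B)

/-- `b ↦ 1 ⊗ b`. -/
def inr : B →+* Tens f g :=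
  letI := f.toAlgebra
  letI := g.toAlgebra
  (Algebra.TensorProduct.includeRight : B →ₐ[R] TensorProduct R A B).toRingHom

theorem inl_comp : (inl f g).comp f = (inr f g).comp g := by
  letI := f.toAlgebra
  letI := g.toAlgebra
  ext r
  change (algebraMap R A r) ⊗ₜ[R] (1 : B) = (1 : A) ⊗ₜ[R] (algebraMap R B r)
  rw [Algebra.algebraMap_eq_smul_one, Algebra.algebraMap_eq_smul_one, TensorProduct.smul_tmul]

variable {f g}

/-- The map `a ⊗ b ↦ φ a * ψ b`. -/
def lift (φ : A →+* C) (ψ : B →+* C) (h : φ.comp f = ψ.comp g) : Tens f g →+* C :=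
  letI := f.toAlgebra
  letI := g.toAlgebra
  letI := (φ.comp f).toAlgebra
  let φ' : A →ₐ[R] C := { φ with commutes' := fun _ => rfl }
  let ψ' : B →ₐ[R] C := { ψ with commutes' := fun r => (RingHom.congr_fun h r).symm }
  (Algebra.TensorProduct.productMap φ' ψ' : TensorProduct R A B →ₐ[R] C).toRingHom

@[simp]
theorem lift_inl (φ : A →+* C) (ψ : B →+* C) (h : φ.comp f = ψ.comp g) (a : A) :
    lift φ ψ h (inl f g a) = φ a := by
  letI := f.toAlgebra
  letI := g.toAlgebra
  change φ a * ψ 1 = φ a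
  rw [map_one, mul_one]

@[simp]
theorem lift_inr (φ : A →+* C) (ψ : B →+* C) (h : φ.comp f = ψ.comp g) (b : B) :
    lift φ ψ h (inr f g b) = ψ b := by
  letI := f.toAlgebra
  letI := g.toAlgebra
  change φ 1 * ψ b = ψ b
  rw [map_one, one_mul]

theorem hom_ext {φ ψ : Tens f g →+* C} (hl : φ.comp (inl f g) = ψ.comp (inl f g))
    (hr : φ.comp (inr f g) = ψ.comp (inr f g)) : φ = ψ := by
  letI := f.toAlgebra
  letI := g.toAlgebra
  ext x
  refine TensorProduct.induction_on (R := R) (M := A) (N := B)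
    (motive := fun x => φ x = ψ x) x ?_ ?_ ?_
  · exact (map_zero φ).trans (map_zero ψ).symm
  · intro a b
    have e : (a ⊗ₜ[R] b : TensorProduct R A B) = (show TensorProduct R A B from
        inl f g a * inr f g b) := by
      change _ = (a ⊗ₜ[R] (1 : B)) * ((1 : A) ⊗ₜ[R] b)
      rw [Algebra.TensorProduct.tmul_mul_tmul, mul_one, one_mul]
    rw [e]
    change φ (inl f g a * inr f g b) = ψ (inl f g a * inr f g b)
    rw [map_mul, map_mul]
    have h1 := RingHom.congr_fun hl a
    have h2 := RingHom.congr_fun hr b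
    simp only [RingHom.comp_apply] at h1 h2
    rw [h1, h2]
  · intro x y hx hy
    exact (map_add φ _ _).trans ((congrArg₂ (· + ·) hx hy).trans (map_add ψ _ _).symm)

end Tens

end Tens

/-! ### Extension of scalars along a ring homomorphism -/

section BaseChange

variable {R S : Type u} [CommRing R] [CommRing S]

/-- The `S`-module `S ⊗_R M` for a ring homomorphism `f : R → S` and an `R`-module `M`. -/
def ScalarExt (f : R →+* S) (M : Type u) [AddCommGroup M] [Module R M] : Type u :=
  @TensorProduct R _ S M _ _ f.toAlgebra.toModule _

namespace ScalarExt

variable (f : R →+* S) (M : Type u) [AddCommGroup M] [Module R M]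

instance : AddCommGroup (ScalarExt f M) :=
  @TensorProduct.addCommGroup R _ S M _ _ f.toAlgebra.toModule _

instance : Module S (ScalarExt f M) :=
  @TensorProduct.leftModule R S _ _ S M _ _ _ f.toAlgebra.toModule _
    (@Algebra.to_smulCommClass R S _ _ f.toAlgebra)

/-- `m ↦ 1 ⊗ m`. -/
def unit : M →ₛₗ[f] ScalarExt f M :=
  letI := f.toAlgebra
  { toFun := fun m => ((1 : S) ⊗ₜ[R] m : TensorProduct R S M)
    map_add' := fun m n => TensorProduct.tmul_add _ _ _
    map_smul' := fun r m => by
      change ((1 : S) ⊗ₜ[R] (r • m) : TensorProduct R S M)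
        = (algebraMap R S r) • ((1 : S) ⊗ₜ[R] m)
      rw [algebraMap_smul, TensorProduct.tmul_smul] }

variable {f M} {N : Type u} [AddCommGroup N] [Module S N]

/-- The `S`-linear map `s ⊗ m ↦ s • φ m` attached to an `f`-semilinear map `φ : M → N`. -/
def lift (φ : M →ₛₗ[f] N) : ScalarExt f M →ₗ[S] N :=
  letI := f.toAlgebra
  letI : Module R N := Module.compHom N f
  haveI : IsScalarTower R S N := ⟨fun r s n => by
    change (f r * s) • n = f r • s • n
    rw [mul_smul]⟩
  let φ' : M →ₗ[R] N := { φ with map_smul' := fun r m => φ.map_smulₛₗ r m }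
  (TensorProduct.AlgebraTensorModule.lift
    ((LinearMap.toSpanSingleton S (M →ₗ[R] N) φ')) : TensorProduct R S M →ₗ[S] N)

@[simp]
theorem lift_unit (φ : M →ₛₗ[f] N) (m : M) : lift φ (unit f M m) = φ m := by
  letI := f.toAlgebra
  change (1 : S) • φ m = φ m
  rw [one_smul]

@[elab_as_elim]
theorem induction_on {P : ScalarExt f M → Prop} (x : ScalarExt f M)
    (smul_unit : ∀ (s : S) (m : M), P (s • unit f M m))
    (add : ∀ x y, P x → P y → P (x + y)) : P x := by
  letI := f.toAlgebra
  refine TensorProduct.induction_on (R := R) (M := S) (N := M) (motive := P) x ?_ ?_ add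
  · have h := smul_unit 0 0
    rwa [zero_smul] at h
  · intro s m
    have e : (s ⊗ₜ[R] m : TensorProduct R S M) = s • ((1 : S) ⊗ₜ[R] m) := by
      rw [TensorProduct.smul_tmul', smul_eq_mul, mul_one]
    rw [e]
    exact smul_unit s m

/-- The map `S ⊗_R M → S' ⊗_R M` induced by `h : S → S'` with `h ∘ f = g`. -/
def map {S' : Type u} [CommRing S'] (h : S →+* S') {g : R →+* S'} (e : h.comp f = g)
    (M : Type u) [AddCommGroup M] [Module R M] : ScalarExt f M →ₛₗ[h] ScalarExt g M :=
  letI : Module S (ScalarExt g M) := Module.compHom _ h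
  let φ : M →ₛₗ[f] ScalarExt g M :=
    { toFun := fun m => unit g M m
      map_add' := fun m n => map_add _ m n
      map_smul' := fun c m => by
        change unit g M (c • m) = h (f c) • unit g M m
        rw [LinearMap.map_smulₛₗ, ← RingHom.comp_apply h f, e] }
  { toFun := fun m => lift φ m
    map_add' := fun m n => map_add _ m n
    map_smul' := fun c m => (lift φ).map_smul c m }

@[simp]
theorem map_unit {S' : Type u} [CommRing S'] (h : S →+* S') {g : R →+* S'}
    (e : h.comp f = g) (m : M) : map h e M (unit f M m) = unit g M m :=
  letI : Module S (ScalarExt g M) := Module.compHom _ h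
  lift_unit _ m

theorem lift_map_bijective {S' : Type u} [CommRing S'] (h : S →+* S') {g : R →+* S'}
    (e : h.comp f = g) (M : Type u) [AddCommGroup M] [Module R M] :
    Function.Bijective (lift (map h e M)) := by
  let η : M →ₛₗ[g] ScalarExt h (ScalarExt f M) :=
    { toFun := fun m => unit h _ (unit f M m)
      map_add' := fun m n => by rw [map_add, map_add]
      map_smul' := fun c m => by
        rw [LinearMap.map_smulₛₗ, LinearMap.map_smulₛₗ, ← e]
        rfl }
  refine Function.bijective_iff_has_inverse.2 ⟨lift η, fun a => ?_, fun b => ?_⟩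
  · refine induction_on a (fun s m => ?_) (fun m n hm hn => ?_)
    · rw [map_smul, lift_unit, map_smul]
      congr 1
      refine induction_on m (fun s m => ?_) (fun m n hm hn => ?_)
      · rw [LinearMap.map_smulₛₗ, map_unit, map_smul, lift_unit, LinearMap.map_smulₛₗ]
        rfl
      · rw [map_add, map_add, hm, hn, map_add]
    · rw [map_add, map_add, hm, hn]
  · refine induction_on b (fun s m => ?_) (fun m n hm hn => ?_)
    · rw [map_smul, lift_unit, map_smul]
      congr 1
      exact (lift_unit _ _).trans (map_unit _ _ _)
    · rw [map_add, map_add, hm, hn]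

end ScalarExt

end BaseChange

/-! ### Finite ringed posets -/

/-- A finite ringed poset: a finite poset `X` with a functor `x ↦ 𝒪_x` to commutative rings.
Open subsets are the upward closed ones, `U_x = {x' ≥ x}` is `Set.Ici x`, and `stalk x` is
`𝒪_x = 𝒪(U_x)`. -/
structure RingedPoset : Type (u + 1) where
  carrier : Type u
  [order : PartialOrder carrier]
  [finite : Finite carrier]
  stalk : carrier → Type u
  [ring : ∀ x, CommRing (stalk x)]
  res : ∀ {x y : carrier}, x ≤ y → (stalk x →+* stalk y)
  res_refl : ∀ (x : carrier) (s : stalk x), res (le_refl x) s = s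
  res_res : ∀ {x y z : carrier} (h : x ≤ y) (k : y ≤ z) (s : stalk x),
    res k (res h s) = res (h.trans k) s

namespace RingedPoset

instance : CoeSort RingedPoset.{u} (Type u) := ⟨carrier⟩

attribute [instance] order finite ring

/-- A morphism of ringed posets: a monotone map `f : X → Y` with a natural transformation
`f⁻¹𝒪_Y → 𝒪_X`. -/
structure Hom (X Y : RingedPoset.{u}) : Type u where
  toFun : X → Y
  mono : ∀ {x x' : X}, x ≤ x' → toFun x ≤ toFun x'
  sharp : ∀ x : X, Y.stalk (toFun x) →+* X.stalk x
  res_sharp : ∀ {x x' : X} (h : x ≤ x') (s : Y.stalk (toFun x)),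
    X.res h (sharp x s) = sharp x' (Y.res (mono h) s)

namespace Hom

variable {X Y Z : RingedPoset.{u}}

instance : CoeFun (Hom X Y) (fun _ => X → Y) := ⟨toFun⟩

/-- The identity. -/
def id (X : RingedPoset.{u}) : Hom X X where
  toFun := fun x => x
  mono := fun h => h
  sharp := fun _ => RingHom.id _
  res_sharp := fun _ _ => rfl

/-- `f` followed by `g`. -/
def comp (f : Hom X Y) (g : Hom Y Z) : Hom X Z where
  toFun := fun x => g (f x)
  mono := fun h => g.mono (f.mono h)
  sharp := fun x => (f.sharp x).comp (g.sharp (f x))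
  res_sharp := fun h s => by
    simp only [RingHom.comp_apply]
    rw [f.res_sharp h, g.res_sharp (f.mono h)]

theorem sharp_congr {f g : Hom X Y} (e : f = g) (x : X) (h : f x ≤ g x) (s : Y.stalk (f x)) :
    g.sharp x (Y.res h s) = f.sharp x s := by
  subst e
  rw [Y.res_refl]

end Hom

theorem Hom.ext_of_sharp {X Y : RingedPoset.{u}} {f g : Hom X Y} (h : ∀ x, f x = g x)
    (hs : ∀ (x : X) (s : Y.stalk (f x)), g.sharp x (Y.res (h x).le s) = f.sharp x s) :
    f = g := by
  obtain ⟨f, f₁, f₂, f₃⟩ := f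
  obtain ⟨g, g₁, g₂, g₃⟩ := g
  obtain rfl : f = g := funext h
  obtain rfl : f₂ = g₂ := funext fun x => RingHom.ext fun s => by
    have e := hs x s
    rw [Y.res_refl] at e
    exact e.symm
  rfl

/-- The ringed poset induced on a subset; it is an open subspace when `U` is upward closed. -/
def restrict (X : RingedPoset.{u}) (U : Set X) : RingedPoset.{u} where
  carrier := U
  stalk := fun x => X.stalk x.1
  res := fun h => X.res h
  res_refl := fun x s => X.res_refl x.1 s
  res_res := fun h k s => X.res_res h k s

/-- The ring of global sections `𝒪_X(X) = lim 𝒪_x`. -/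
def sections (X : RingedPoset.{u}) : Subring (∀ x : X, X.stalk x) where
  carrier := {s | ∀ (x y : X) (h : x ≤ y), X.res h (s x) = s y}
  mul_mem' := fun ha hb x y h => by
    simp only [Pi.mul_apply, map_mul, ha x y h, hb x y h]
  one_mem' := fun x y h => by simp only [Pi.one_apply, map_one]
  add_mem' := fun ha hb x y h => by
    simp only [Pi.add_apply, map_add, ha x y h, hb x y h]
  zero_mem' := fun x y h => by simp only [Pi.zero_apply, map_zero]
  neg_mem' := fun ha x y h => by simp only [Pi.neg_apply, map_neg, ha x y h]

/-- The restriction `𝒪_X(X) → 𝒪_x`. -/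
def germ (X : RingedPoset.{u}) (x : X) : X.sections →+* X.stalk x :=
  (Pi.evalRingHom X.stalk x).comp X.sections.subtype

theorem res_germ (X : RingedPoset.{u}) {x y : X} (h : x ≤ y) :
    (X.res h).comp (X.germ x) = X.germ y :=
  RingHom.ext fun s => s.2 x y h

/-! ### Schematic spaces and schematic morphisms -/

/-- The morphism `𝒪_x ⊗_{𝒪_t} 𝒪_y → ∏_{z ≥ x, y} 𝒪_z` for `t ≤ x, y`. -/
def tensorToProd (X : RingedPoset.{u}) {t x y : X} (hx : t ≤ x) (hy : t ≤ y) :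
    Tens (X.res hx) (X.res hy) →+* (∀ z : {z : X // x ≤ z ∧ y ≤ z}, X.stalk z.1) :=
  Tens.lift (RingHom.pi fun z => X.res z.2.1) (RingHom.pi fun z => X.res z.2.2) (by
    ext s z
    simp only [RingHom.comp_apply, RingHom.pi_apply]
    rw [X.res_res, X.res_res])

/-- Schematic finite ringed posets. -/
def IsSchematic (X : RingedPoset.{u}) : Prop :=
  (∀ (x y : X) (h : x ≤ y), (X.res h).Flat) ∧
  ∀ (t x y : X) (hx : t ≤ x) (hy : t ≤ y), (X.tensorToProd hx hy).FaithfullyFlat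

namespace Hom

variable {X Y : RingedPoset.{u}}

/-- The morphism `𝒪_{X,x} ⊗_{𝒪_{Y,f(x)}} 𝒪_{Y,y} → ∏_{z ∈ U_x ∩ f⁻¹(U_y)} 𝒪_{X,z}` for
`y ≥ f(x)`. -/
def tensorToProd (f : Hom X Y) {x : X} {y : Y} (h : f x ≤ y) :
    Tens (f.sharp x) (Y.res h) →+* (∀ z : {z : X // x ≤ z ∧ y ≤ f z}, X.stalk z.1) :=
  Tens.lift (RingHom.pi fun z => X.res z.2.1)
    (RingHom.pi fun z => (f.sharp z.1).comp (Y.res z.2.2)) (by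
    ext s z
    simp only [RingHom.comp_apply, RingHom.pi_apply]
    rw [f.res_sharp, Y.res_res])

/-- Schematic morphisms (between schematic spaces). -/
def IsSchematic (f : Hom X Y) : Prop :=
  ∀ (x : X) (y : Y) (h : f x ≤ y),
    Function.Surjective (PrimeSpectrum.comap (f.tensorToProd h))

/-- Flat morphisms. -/
def IsFlat (f : Hom X Y) : Prop := ∀ x : X, (f.sharp x).Flat

end Hom

/-! ### Quasi-coherent modules, `Mod`-affine spaces and qc-isomorphisms -/

/-- A sheaf of modules on a ringed poset, given by its stalks and restriction maps. -/
structure SheafModule (X : RingedPoset.{u}) : Type (u + 1) where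
  stalk : X → Type u
  [group : ∀ x, AddCommGroup (stalk x)]
  [module : ∀ x, Module (X.stalk x) (stalk x)]
  res : ∀ {x y : X} (h : x ≤ y), stalk x →ₛₗ[X.res h] stalk y
  res_refl : ∀ (x : X) (m : stalk x), res (le_refl x) m = m
  res_res : ∀ {x y z : X} (h : x ≤ y) (k : y ≤ z) (m : stalk x),
    res k (res h m) = res (h.trans k) m

namespace SheafModule

attribute [instance] group module

variable {X : RingedPoset.{u}}

/-- `N` is quasi-coherent if `𝒪_y ⊗_{𝒪_x} N_x → N_y` is an isomorphism for all `x ≤ y`. -/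
def IsQuasicoherent (N : SheafModule X) : Prop :=
  ∀ (x y : X) (h : x ≤ y), Function.Bijective (ScalarExt.lift (N.res h))

/-- The `𝒪_X(X)`-module of global sections `π_* N = lim N_x`. -/
def sections (N : SheafModule X) : Submodule X.sections (∀ x : X, N.stalk x) where
  carrier := {s | ∀ (x y : X) (h : x ≤ y), N.res h (s x) = s y}
  add_mem' := fun ha hb x y h => by
    simp only [Pi.add_apply, map_add, ha x y h, hb x y h]
  zero_mem' := fun x y h => by simp only [Pi.zero_apply, map_zero]
  smul_mem' := fun c a ha x y h => by
    change N.res h (c.1 x • a x) = c.1 y • a y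
    rw [LinearMap.map_smulₛₗ, ha x y h, c.2 x y h]

/-- The restriction `Γ(X, N) → N_x`. -/
def germ (N : SheafModule X) (x : X) : N.sections →ₛₗ[X.germ x] N.stalk x where
  toFun := fun s => s.1 x
  map_add' := fun _ _ => rfl
  map_smul' := fun _ _ => rfl

/-- The sheaf of modules `π^* M`, with stalks `𝒪_x ⊗_{𝒪_X(X)} M`, for
`π : X → (⋆, 𝒪_X(X))`. -/
def pullback (X : RingedPoset.{u}) (M : Type u) [AddCommGroup M] [Module X.sections M] :
    SheafModule X where
  stalk := fun x => ScalarExt (X.germ x) M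
  res := fun h => ScalarExt.map (X.res h) (X.res_germ h) M
  res_refl := fun x m => by
    refine ScalarExt.induction_on m (fun s m => ?_) (fun m n hm hn => ?_)
    · rw [LinearMap.map_smulₛₗ, ScalarExt.map_unit, X.res_refl]
    · rw [map_add, hm, hn]
  res_res := fun h k m => by
    refine ScalarExt.induction_on m (fun s m => ?_) (fun m n hm hn => ?_)
    · simp only [LinearMap.map_smulₛₗ, ScalarExt.map_unit, X.res_res]
    · simp only [map_add, hm, hn]

theorem pullback_isQuasicoherent (X : RingedPoset.{u}) (M : Type u) [AddCommGroup M]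
    [Module X.sections M] : (pullback X M).IsQuasicoherent :=
  fun _ _ h => ScalarExt.lift_map_bijective (X.res h) (X.res_germ h) M

/-- The unit `M → π_* π^* M`. -/
def unit (X : RingedPoset.{u}) (M : Type u) [AddCommGroup M] [Module X.sections M] :
    M →ₗ[X.sections] (pullback X M).sections where
  toFun := fun m => ⟨fun x => ScalarExt.unit (X.germ x) M m, fun _ _ h =>
    ScalarExt.map_unit (X.res h) (X.res_germ h) m⟩
  map_add' := fun m n => Subtype.ext (funext fun _ => map_add _ m n)
  map_smul' := fun c m => Subtype.ext (funext fun x =>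
    LinearMap.map_smulₛₗ (ScalarExt.unit (X.germ x) M) c m)

/-- The counit `π^* π_* N → N` at the point `x`. -/
def counit (N : SheafModule X) (x : X) :
    (pullback X N.sections).stalk x →ₗ[X.stalk x] N.stalk x :=
  ScalarExt.lift (N.germ x)

end SheafModule

/-- `X` is `Mod`-affine: for `π : X → (⋆, 𝒪_X(X))`, the adjunction `π^* ⊣ π_*` between
quasi-coherent `𝒪_X`-modules and `𝒪_X(X)`-modules is an adjoint equivalence, that is, its unit
and its counit are isomorphisms. -/
def IsModAffine (X : RingedPoset.{u}) : Prop :=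
  (∀ (M : Type u) [AddCommGroup M] [Module X.sections M],
    Function.Bijective (SheafModule.unit X M)) ∧
  ∀ N : SheafModule X, N.IsQuasicoherent → ∀ x : X, Function.Bijective (N.counit x)

namespace Hom

variable {X Y : RingedPoset.{u}}

/-- The morphism `f_♯ : 𝒪_Y → f_* 𝒪_X` at `y`, that is, `𝒪_{Y,y} → 𝒪_X(f⁻¹(U_y))`. -/
def toPushforward (f : Hom X Y) (y : Y) :
    Y.stalk y →+* (X.restrict {x | y ≤ f x}).sections :=
  RingHom.codRestrict (RingHom.pi fun x : {x | y ≤ f x} => (f.sharp x.1).comp (Y.res x.2)) _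
    (fun s x x' h => by
      exact (f.res_sharp h (Y.res x.2 s)).trans
        (congrArg (f.sharp x'.1) (Y.res_res x.2 (f.mono h) s)))

/-- A qc-isomorphism: `f⁻¹(U_y)` is `Mod`-affine for all `y`, and `𝒪_Y → f_* 𝒪_X` is an
isomorphism. -/
def IsQCIso (f : Hom X Y) : Prop :=
  (∀ y : Y, (X.restrict {x | y ≤ f x}).IsModAffine) ∧
  ∀ y : Y, Function.Bijective (f.toPushforward y)

end Hom

/-! ### Fibered products and flat immersions -/

section FiberProduct

variable {X Y S W : RingedPoset.{u}}

theorem fiberProd_aux (f : Hom X S) (g : Hom Y S) {x x' : X} {y y' : Y} (e : f x = g y)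
    (e' : f x' = g y') (h : x ≤ x') (k : y ≤ y') :
    ((Tens.inl (f.sharp x') ((g.sharp y').comp (S.res e'.le))).comp (X.res h)).comp (f.sharp x) =
      ((Tens.inr (f.sharp x') ((g.sharp y').comp (S.res e'.le))).comp (Y.res k)).comp
        ((g.sharp y).comp (S.res e.le)) := by
  ext s
  have c := RingHom.congr_fun
    (Tens.inl_comp (f.sharp x') ((g.sharp y').comp (S.res e'.le))) (S.res (f.mono h) s)
  simp only [RingHom.comp_apply] at c ⊢
  rw [f.res_sharp, c, g.res_sharp, S.res_res, S.res_res]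

/-- The fibered product `X ×_S Y`: the fibered product of posets, with
`𝒪_{(x, y)} = 𝒪_{X,x} ⊗_{𝒪_{S,s}} 𝒪_{Y,y}` for `s` the common image of `x` and `y`. -/
def fiberProd (f : Hom X S) (g : Hom Y S) : RingedPoset.{u} where
  carrier := {z : X × Y // f z.1 = g z.2}
  stalk := fun z => Tens (f.sharp z.1.1) ((g.sharp z.1.2).comp (S.res z.2.le))
  res := fun {z z'} (h : z.1 ≤ z'.1) =>
    Tens.lift ((Tens.inl _ _).comp (X.res h.1)) ((Tens.inr _ _).comp (Y.res h.2))
      (fiberProd_aux f g z.2 z'.2 h.1 h.2)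
  res_refl := fun z s => by
    refine RingHom.congr_fun (g := RingHom.id _) (Tens.hom_ext ?_ ?_) s <;> ext a <;>
      simp [X.res_refl, Y.res_refl]
  res_res := fun h k s => by
    rw [← RingHom.comp_apply]
    refine RingHom.congr_fun (Tens.hom_ext ?_ ?_) s <;> ext a <;>
      simp [X.res_res, Y.res_res]

theorem fiberProd_res_inl (f : Hom X S) (g : Hom Y S) {z z' : fiberProd f g} (h : z ≤ z')
    (h₁ : z.1.1 ≤ z'.1.1) (s : X.stalk z.1.1) :
    (fiberProd f g).res h (Tens.inl _ _ s) = Tens.inl _ _ (X.res h₁ s) :=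
  Tens.lift_inl ((Tens.inl _ _).comp (X.res h₁)) ((Tens.inr _ _).comp (Y.res _))
    (fiberProd_aux f g z.2 z'.2 h₁ (show z.1 ≤ z'.1 from h).2) s

theorem fiberProd_res_inr (f : Hom X S) (g : Hom Y S) {z z' : fiberProd f g} (h : z ≤ z')
    (h₂ : z.1.2 ≤ z'.1.2) (s : Y.stalk z.1.2) :
    (fiberProd f g).res h (Tens.inr _ _ s) = Tens.inr _ _ (Y.res h₂ s) :=
  Tens.lift_inr ((Tens.inl _ _).comp (X.res _)) ((Tens.inr _ _).comp (Y.res h₂))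
    (fiberProd_aux f g z.2 z'.2 (show z.1 ≤ z'.1 from h).1 h₂) s

theorem fiberLift_comm {f : Hom X S} {g : Hom Y S} (a : Hom W X) (b : Hom W Y)
    (e : a.comp f = b.comp g) (w : W) : f (a w) = g (b w) :=
  congrArg (fun k : Hom W S => k w) e

theorem fiberLift_aux {f : Hom X S} {g : Hom Y S} (a : Hom W X) (b : Hom W Y)
    (e : a.comp f = b.comp g) (w : W) :
    (a.sharp w).comp (f.sharp (a w)) = (b.sharp w).comp ((g.sharp (b w)).comp
      (S.res (fiberLift_comm a b e w).le)) :=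
  RingHom.ext fun s =>
    (Hom.sharp_congr e w (fiberLift_comm a b e w).le s).symm

/-- The morphism `W → X ×_S Y` with components `a` and `b`. -/
def fiberLift {f : Hom X S} {g : Hom Y S} (a : Hom W X) (b : Hom W Y)
    (e : a.comp f = b.comp g) : Hom W (fiberProd f g) where
  toFun := fun w => ⟨(a w, b w), fiberLift_comm a b e w⟩
  mono := fun h => ⟨a.mono h, b.mono h⟩
  sharp := fun w => Tens.lift (a.sharp w) (b.sharp w) (fiberLift_aux a b e w)
  res_sharp := fun {w w'} h s => by
    let φ := Tens.lift (a.sharp w) (b.sharp w) (fiberLift_aux a b e w)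
    let φ' := Tens.lift (a.sharp w') (b.sharp w') (fiberLift_aux a b e w')
    let x : fiberProd f g := ⟨(a w, b w), fiberLift_comm a b e w⟩
    let x' : fiberProd f g := ⟨(a w', b w'), fiberLift_comm a b e w'⟩
    have hx : x ≤ x' := ⟨a.mono h, b.mono h⟩
    have H : (W.res h).comp φ = φ'.comp ((fiberProd f g).res hx) := by
      refine Tens.hom_ext ?_ ?_
      · ext t
        exact ((congrArg (W.res h) (Tens.lift_inl _ _ _ t)).trans (a.res_sharp h t)).trans
          ((congrArg φ' (fiberProd_res_inl f g hx (a.mono h) t)).trans (Tens.lift_inl _ _ _ _)).symm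
      · ext t
        exact ((congrArg (W.res h) (Tens.lift_inr _ _ _ t)).trans (b.res_sharp h t)).trans
          ((congrArg φ' (fiberProd_res_inr f g hx (b.mono h) t)).trans (Tens.lift_inr _ _ _ _)).symm
    exact RingHom.congr_fun H s

/-- The diagonal `Δ_f : X → X ×_S X`. -/
def Hom.diagonal (f : Hom X S) : Hom X (fiberProd f f) :=
  fiberLift (Hom.id X) (Hom.id X) rfl

/-- Flat immersions: flat morphisms whose diagonal is a qc-isomorphism. -/
def Hom.IsFlatImmersion (f : Hom X S) : Prop :=
  f.IsFlat ∧ f.diagonal.IsQCIso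

end FiberProduct

end RingedPoset

/-! ### Data and cylinders -/

open RingedPoset

/-- A datum with values in the opposite of the category of ringed posets: a finite poset `P` with
a functor `p ↦ 𝒳(p)` from `P` to the opposite category, so that `p ≤ q` gives a restriction
morphism `𝒳_{pq} : 𝒳(q) → 𝒳(p)`. -/
structure RingedDatum : Type (u + 1) where
  index : Type u
  [order : PartialOrder index]
  [finite : Finite index]
  obj : index → RingedPoset.{u}
  map : ∀ {p q : index}, p ≤ q → Hom (obj q) (obj p)
  map_refl : ∀ p : index, map (le_refl p) = Hom.id (obj p)
  map_map : ∀ {p q r : index} (h : p ≤ q) (k : q ≤ r),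
    (map k).comp (map h) = map (h.trans k)

namespace RingedDatum

attribute [instance] order finite

/-- The datum takes values in (the opposite of) the category of schematic spaces and schematic
morphisms. -/
def IsSchematic (D : RingedDatum.{u}) : Prop :=
  (∀ p, (D.obj p).IsSchematic) ∧ ∀ (p q : D.index) (h : p ≤ q), (D.map h).IsSchematic

theorem map_refl_apply (D : RingedDatum.{u}) {p : D.index} (h : p ≤ p) (x : D.obj p) :
    D.map h x = x :=
  congrArg (fun k : Hom (D.obj p) (D.obj p) => k x) (D.map_refl p)

theorem map_map_apply (D : RingedDatum.{u}) {p q r : D.index} (h : p ≤ q) (k : q ≤ r)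
    (x : D.obj r) : D.map h (D.map k x) = D.map (h.trans k) x :=
  congrArg (fun k : Hom (D.obj r) (D.obj p) => k x) (D.map_map h k)

/-- The points of the cylinder. -/
@[ext]
structure CylPoint (D : RingedDatum.{u}) : Type u where
  base : D.index
  pt : D.obj base

instance (D : RingedDatum.{u}) : Finite D.CylPoint :=
  Finite.of_injective (fun z => (⟨z.base, z.pt⟩ : Σ p : D.index, D.obj p)) (by
    rintro ⟨p, x⟩ ⟨q, y⟩ h
    cases h
    rfl)

/-- `x_p ≤ y_q` if `p ≤ q` and `x_p ≤ 𝒳_{pq}(y_q)`. -/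
instance (D : RingedDatum.{u}) : PartialOrder D.CylPoint where
  le := fun a b => ∃ h : a.base ≤ b.base, a.pt ≤ D.map h b.pt
  le_refl := fun a => ⟨le_refl _, (D.map_refl_apply _ _).ge⟩
  le_trans := fun a b c ⟨h, h'⟩ ⟨k, k'⟩ =>
    ⟨h.trans k, (h'.trans ((D.map h).mono k')).trans (D.map_map_apply h k c.pt).le⟩
  le_antisymm := by
    rintro ⟨p, x⟩ ⟨q, y⟩ ⟨h, h'⟩ ⟨k, k'⟩
    obtain rfl : p = q := le_antisymm h k
    obtain rfl : x = y := le_antisymm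
      (h'.trans (D.map_refl_apply h y).le) (k'.trans (D.map_refl_apply k x).le)
    rfl

theorem CylPoint.base_le {D : RingedDatum.{u}} {a b : D.CylPoint} (h : a ≤ b) :
    a.base ≤ b.base := h.1

theorem CylPoint.pt_le {D : RingedDatum.{u}} {a b : D.CylPoint} (h : a ≤ b) :
    a.pt ≤ D.map (CylPoint.base_le h) b.pt := h.2

theorem sharp_map_map (D : RingedDatum.{u}) {p q r : D.index} (h : p ≤ q) (k : q ≤ r)
    (x : D.obj r) (y : D.obj p) (hy : y ≤ D.map h (D.map k x)) (s : (D.obj p).stalk y) :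
    (D.map k).sharp x ((D.map h).sharp (D.map k x) ((D.obj p).res hy s)) =
      (D.map (h.trans k)).sharp x
        ((D.obj p).res (hy.trans (D.map_map_apply h k x).le) s) := by
  have e := Hom.sharp_congr (D.map_map h k) x (D.map_map_apply h k x).le ((D.obj p).res hy s)
  exact e.symm.trans (congrArg _ ((D.obj p).res_res _ _ s))

/-- The cylinder `Cyl(𝒳)`: its points are pairs of `p` and `x ∈ 𝒳(p)`, and its stalk at such a
point is `𝒪_{𝒳(p),x}`. -/
def cyl (D : RingedDatum.{u}) : RingedPoset.{u} where
  carrier := D.CylPoint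
  stalk := fun a => (D.obj a.base).stalk a.pt
  res := fun {a b} h => ((D.map (CylPoint.base_le h)).sharp b.pt).comp
    ((D.obj a.base).res (CylPoint.pt_le h))
  res_refl := fun a s =>
    Hom.sharp_congr (D.map_refl a.base).symm a.pt (D.map_refl_apply (le_refl a.base) a.pt).ge s
  res_res := fun {a b c} h k s => by
    simp only [RingHom.comp_apply]
    rw [(D.map (CylPoint.base_le h)).res_sharp, (D.obj a.base).res_res, D.sharp_map_map]

/-- The datum induced on a subset of the index poset. -/
def restrict (D : RingedDatum.{u}) (U : Set D.index) : RingedDatum.{u} where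
  index := U
  obj := fun p => D.obj p.1
  map := fun {p q} h => D.map (p := p.1) (q := q.1) h
  map_refl := fun p => D.map_refl p.1
  map_map := fun {p q r} h k => D.map_map (p := p.1) (q := q.1) (r := r.1) h k

/-- The inclusion `Cyl(U) → Cyl(V)` for `U ⊆ V`. -/
def cylIncl (D : RingedDatum.{u}) {U V : Set D.index} (hUV : U ⊆ V) :
    Hom (D.restrict U).cyl (D.restrict V).cyl where
  toFun := fun a => ⟨⟨a.base.1, hUV a.base.2⟩, a.pt⟩
  mono := fun h => h
  sharp := fun a => RingHom.id ((D.restrict U).cyl.stalk a)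
  res_sharp := fun _ _ => rfl

/-- The projection `π_p : Cyl(U_p) → 𝒳(p)`, equal to `𝒳_{pr}` on the points of `𝒳(r)`. -/
def cylProj (D : RingedDatum.{u}) (p : D.index) :
    Hom (D.restrict (Set.Ici p)).cyl (D.obj p) where
  toFun := fun a => D.map a.base.2 a.pt
  mono := fun {a b} h =>
    ((D.map a.base.2).mono (CylPoint.pt_le h)).trans
      (D.map_map_apply (q := a.base.1) (r := b.base.1) a.base.2 (CylPoint.base_le h) b.pt).le
  sharp := fun a => (D.map a.base.2).sharp a.pt
  res_sharp := fun {a b} h s => by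
    have e := D.sharp_map_map (q := a.base.1) (r := b.base.1) a.base.2 (CylPoint.base_le h)
      b.pt _ ((D.map a.base.2).mono (CylPoint.pt_le h)) s
    refine Eq.trans ?_ e
    exact congrArg _ ((D.map a.base.2).res_sharp (CylPoint.pt_le h) s)

theorem cylProj_comp_map (D : RingedDatum.{u}) {t p : D.index} (hp : t ≤ p) {U : Set D.index}
    (hU : U ⊆ Set.Ici p) :
    ((D.cylIncl hU).comp (D.cylProj p)).comp (D.map hp) =
      (D.cylIncl (hU.trans (Set.Ici_subset_Ici.2 hp))).comp (D.cylProj t) := by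
  refine Hom.ext_of_sharp (fun a => D.map_map_apply hp (hU a.base.2) a.pt) fun a s => ?_
  exact Hom.sharp_congr (D.map_map hp (hU a.base.2)) a.pt
    (D.map_map_apply hp (hU a.base.2) a.pt).le s

/-- The morphism `π^t_{pq} : Cyl(U_p ∩ U_q) → 𝒳(p) ×_{𝒳(t)} 𝒳(q)` induced by the composites
`Cyl(U_p ∩ U_q) → Cyl(U_p) → 𝒳(p)` and `Cyl(U_p ∩ U_q) → Cyl(U_q) → 𝒳(q)`. -/
def cylPi (D : RingedDatum.{u}) {t p q : D.index} (hp : t ≤ p) (hq : t ≤ q) :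
    Hom (D.restrict (Set.Ici p ∩ Set.Ici q)).cyl (fiberProd (D.map hp) (D.map hq)) :=
  fiberLift
    ((D.cylIncl Set.inter_subset_left).comp (D.cylProj p))
    ((D.cylIncl Set.inter_subset_right).comp (D.cylProj q))
    ((D.cylProj_comp_map hp _).trans (D.cylProj_comp_map hq _).symm)

end RingedDatum

end

/-! The condition defining schematic spaces is translated into one about primes. Faithful flatness
of `𝒪_x ⊗ 𝒪_y → ∏ 𝒪_z` with `x = y` forces restrictions to be flat epimorphisms, and these are
injective on spectra. Hence every stalk above `t` may be seen as a subset of `Spec 𝒪_t`, and being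
schematic means: restrictions are flat epimorphisms, and a prime of `Spec 𝒪_t` lying in `Spec 𝒪_x`
and `Spec 𝒪_y` lies in `Spec 𝒪_z` for some `z ≥ x, y` (`isSchematic_of_exists_mem_range`).
Injectivity of the structure map of the diagonal shows that flat immersions are epimorphisms on
stalks, so the restrictions of the cylinder are always flat epimorphisms and only the condition on
primes is at stake.

For `z = (x, y)` in the fibered product, `z ≤ π w` says exactly that `w` lies above both `x` and `y`
in the cylinder, and `𝒪_z = 𝒪_x ⊗ 𝒪_y`. If the cylinder is schematic, the points `w` with `z ≤ π w`
therefore cover `Spec 𝒪_z` by flat monomorphisms whose overlaps are again covered by points of the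
same kind (`isAffineCover_cylPiRes`). Flat descent for such a finite cover identifies quasi-coherent
modules with `𝒪_z`-modules (`IsAffineCover.isModAffine`) and `𝒪_z` with the ring of sections
(`IsAffineCover.bijective_toSections`), so `π` is a qc-isomorphism.

Conversely, a prime in the images of `x` and `y` is moved to a point `(x', y')` of the fibered
product above them (`exists_fiberProd_mem_range`). A `Mod`-affine space covers the spectrum of its
sections, since otherwise some nonzero residue field would pull back to zero
(`IsModAffine.exists_mem_range`). So the qc-isomorphism `π` provides a point `w` above `x'` and `y'`
whose spectrum contains the prime. -/

noncomputable section

/-! ### Epimorphisms of rings and prime spectra -/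

section Epi

variable {R S A B C : Type u} [CommRing R] [CommRing S] [CommRing A] [CommRing B] [CommRing C]

/-- Epimorphisms of commutative rings. -/
def RingHom.IsEpic (f : R →+* S) : Prop :=
  ∀ (C : Type u) [CommRing C] (g h : S →+* C), g.comp f = h.comp f → g = h

namespace RingHom.IsEpic

/-- Any pair of maps that agree on `R` factors through `S ⊗_R S`, the universal such pair. -/
theorem of_inl_eq_inr {f : R →+* S} (h : Tens.inl f f = Tens.inr f f) : f.IsEpic := by
  intro C _ a b e
  have h1 : (Tens.lift a b e).comp (Tens.inl f f) = a := RingHom.ext fun x => Tens.lift_inl a b e x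
  have h2 : (Tens.lift a b e).comp (Tens.inr f f) = b := RingHom.ext fun x => Tens.lift_inr a b e x
  rw [← h1, h, h2]

theorem comp {f : R →+* S} {g : S →+* A} (hf : f.IsEpic) (hg : g.IsEpic) :
    (g.comp f).IsEpic :=
  fun C _ a b e => hg C a b (hf C _ _ e)

theorem of_comp {f : R →+* S} {g : S →+* A} (h : (g.comp f).IsEpic) : g.IsEpic :=
  fun C _ a b e => h C a b (by rw [← RingHom.comp_assoc, e, RingHom.comp_assoc])

theorem of_bijective {f : R →+* S} (h : Function.Bijective f) : f.IsEpic :=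
  fun C _ a b e => RingHom.ext fun s => by
    obtain ⟨r, rfl⟩ := h.2 s
    exact RingHom.congr_fun e r

theorem inl_comp {f : R →+* A} {g : R →+* B} (hf : f.IsEpic) (hg : g.IsEpic) :
    ((Tens.inl f g).comp f).IsEpic := fun C _ a b e =>
  Tens.hom_ext (hf C _ _ e) (hg C _ _ (by
    rw [RingHom.comp_assoc, RingHom.comp_assoc, ← Tens.inl_comp]; exact e))

theorem algebra_isEpi {f : R →+* S} (hf : f.IsEpic) : @Algebra.IsEpi R S _ _ f.toAlgebra := by
  letI := f.toAlgebra
  rw [Algebra.isEpi_iff_forall_one_tmul_eq]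
  intro a
  exact (RingHom.congr_fun (hf _ (Tens.inl f f) (Tens.inr f f) (Tens.inl_comp f f)) a).symm

/-- If `f` is an epimorphism and `g ∘ f` is flat, then `g` is flat. -/
theorem flat_of_comp {f : R →+* S} {g : S →+* A} (hf : f.IsEpic) (h : (g.comp f).Flat) :
    g.Flat := by
  letI := f.toAlgebra
  letI := g.toAlgebra
  letI := (g.comp f).toAlgebra
  haveI : IsScalarTower R S A := IsScalarTower.of_algebraMap_eq fun _ => rfl
  haveI := hf.algebra_isEpi
  haveI : Module.Flat R A := h
  change Module.Flat S A
  -- For an epimorphism `R → S`, the multiplication `S ⊗_R A → A` is bijective, and `S ⊗_R A` is the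
  -- base change to `S` of a flat `R`-module.
  let p : TensorProduct R S A →ₗ[S] A :=
    TensorProduct.AlgebraTensorModule.lift (LinearMap.restrictScalars₁₂ S R (LinearMap.lsmul S A))
  have hp : Function.Bijective p := by
    refine ⟨?_, fun a => ⟨1 ⊗ₜ a, one_smul S a⟩⟩
    have := Algebra.injective_lift_lsmul R S A
    exact this
  exact Module.Flat.of_linearEquiv (LinearEquiv.ofBijective p hp).symm

end RingHom.IsEpic

/-- Two primes with the same image are the kernels of two compatible maps to a field. -/
theorem PrimeSpectrum.exists_field_of_comap_eq (f : R →+* A) (g : R →+* B)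
    (p : PrimeSpectrum A) (q : PrimeSpectrum B)
    (h : PrimeSpectrum.comap f p = PrimeSpectrum.comap g q) :
    ∃ (K : Type u) (_ : Field K) (a : A →+* K) (b : B →+* K), a.comp f = b.comp g ∧
      RingHom.ker a = p.asIdeal ∧ RingHom.ker b = q.asIdeal := by
  let r := PrimeSpectrum.comap f p
  have hr : r.asIdeal = q.asIdeal.comap g := congrArg PrimeSpectrum.asIdeal h
  let α := Ideal.ResidueField.map r.asIdeal p.asIdeal f rfl
  let β := Ideal.ResidueField.map r.asIdeal q.asIdeal g hr
  letI := α.toAlgebra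
  letI := β.toAlgebra
  -- A tensor product of two field extensions is nonzero, so a residue field of it is a common
  -- extension of both.
  let T := TensorProduct r.asIdeal.ResidueField p.asIdeal.ResidueField q.asIdeal.ResidueField
  haveI : Nontrivial T := inferInstance
  obtain ⟨m, hm⟩ := Ideal.exists_maximal T
  letI := Ideal.Quotient.field m
  let a' : p.asIdeal.ResidueField →+* T ⧸ m :=
    (Ideal.Quotient.mk m).comp (Algebra.TensorProduct.includeLeftRingHom)
  let b' : q.asIdeal.ResidueField →+* T ⧸ m :=
    (Ideal.Quotient.mk m).comp
      (Algebra.TensorProduct.includeRight (R := r.asIdeal.ResidueField)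
        (A := p.asIdeal.ResidueField) (B := q.asIdeal.ResidueField)).toRingHom
  refine ⟨T ⧸ m, inferInstance, a'.comp (algebraMap A _), b'.comp (algebraMap B _), ?_, ?_, ?_⟩
  · ext x
    have h1 : algebraMap A p.asIdeal.ResidueField (f x) = α (algebraMap R _ x) := by
      exact (Ideal.ResidueField.map_algebraMap ..).symm
    have h2 : algebraMap B q.asIdeal.ResidueField (g x) = β (algebraMap R _ x) := by
      exact (Ideal.ResidueField.map_algebraMap ..).symm
    simp only [RingHom.comp_apply]
    rw [h1, h2]
    exact congrArg (Ideal.Quotient.mk m) (RingHom.congr_fun (Tens.inl_comp α β) (algebraMap R _ x))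
  · rw [← RingHom.comap_ker, (RingHom.injective_iff_ker_eq_bot a').1 a'.injective,
      ← RingHom.ker_eq_comap_bot, Ideal.ker_algebraMap_residueField]
  · rw [← RingHom.comap_ker, (RingHom.injective_iff_ker_eq_bot b').1 b'.injective,
      ← RingHom.ker_eq_comap_bot, Ideal.ker_algebraMap_residueField]

/-- Two primes over the same prime are kernels of two maps to one field that agree on `R`; an
epimorphism makes these maps equal. -/
theorem RingHom.IsEpic.comap_injective {f : R →+* S} (hf : f.IsEpic) :
    Function.Injective (PrimeSpectrum.comap f) := by
  intro p q h
  obtain ⟨K, _, a, b, e, ha, hb⟩ := PrimeSpectrum.exists_field_of_comap_eq f f p q h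
  obtain rfl := hf K a b e
  exact PrimeSpectrum.ext (ha.symm.trans hb)

/-- The required prime is the kernel of the map from the tensor product to a common extension of the
residue fields. -/
theorem Tens.exists_comap_eq (f : R →+* A) (g : R →+* B)
    (p : PrimeSpectrum A) (q : PrimeSpectrum B)
    (h : PrimeSpectrum.comap f p = PrimeSpectrum.comap g q) :
    ∃ t : PrimeSpectrum (Tens f g), PrimeSpectrum.comap (Tens.inl f g) t = p ∧
      PrimeSpectrum.comap (Tens.inr f g) t = q := by
  obtain ⟨K, _, a, b, e, ha, hb⟩ := PrimeSpectrum.exists_field_of_comap_eq f g p q h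
  refine ⟨⟨RingHom.ker (Tens.lift a b e), RingHom.ker_isPrime _⟩, PrimeSpectrum.ext ?_,
    PrimeSpectrum.ext ?_⟩
  · rw [← ha]
    ext x
    simp [RingHom.mem_ker]
  · rw [← hb]
    ext x
    simp [RingHom.mem_ker]

end Epi

/-! ### Maps from a tensor product to a finite product, on spectra -/

section TensToPi

open PrimeSpectrum

variable {R A B : Type u} [CommRing R] [CommRing A] [CommRing B] {Z : Type u}
  {O : Z → Type u} [∀ z, CommRing (O z)]

theorem flat_of_forall_flat_eval [Finite Z] {φ : A →+* ∀ z, O z}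
    (h : ∀ z, ((Pi.evalRingHom O z).comp φ).Flat) : φ.Flat := by
  classical
  letI := φ.toAlgebra
  letI : ∀ z, Module A (O z) := fun z => ((Pi.evalRingHom O z).comp φ).toAlgebra.toModule
  haveI : ∀ z, Module.Flat A (O z) := h
  cases nonempty_fintype Z
  have e := (DirectSum.linearEquivFunOnFintype A Z O).symm
  exact Module.Flat.of_linearEquiv e

variable {f : R →+* A} {g : R →+* B} {α : ∀ z, A →+* O z} {β : ∀ z, B →+* O z}

/-- Since `R → A ⊗_R B` is an epimorphism, flatness over `A ⊗_R B` can be checked over `R`, one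
factor at a time. -/
theorem Tens.flat_lift_pi [Finite Z] (hf : f.IsEpic) (hg : g.IsEpic)
    (e : (RingHom.pi α).comp f = (RingHom.pi β).comp g) (h : ∀ z, ((α z).comp f).Flat) :
    (Tens.lift (RingHom.pi α) (RingHom.pi β) e).Flat := by
  refine flat_of_forall_flat_eval fun z => (hf.inl_comp hg).flat_of_comp ?_
  convert h z using 1
  ext r
  simp

/-- A prime in both images lifts to `A ⊗_R B`, then to the product, and a prime of a finite product
lives on a single factor. -/
theorem Tens.exists_mem_range_of_surjective_comap [Finite Z]
    (e : (RingHom.pi α).comp f = (RingHom.pi β).comp g)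
    (h : Function.Surjective (comap (Tens.lift (RingHom.pi α) (RingHom.pi β) e)))
    {p : PrimeSpectrum R} (hp : p ∈ Set.range (comap f)) (hp' : p ∈ Set.range (comap g)) :
    ∃ z, p ∈ Set.range (comap ((α z).comp f)) := by
  obtain ⟨a, rfl⟩ := hp
  obtain ⟨b, hb⟩ := hp'
  obtain ⟨t, rfl, rfl⟩ := Tens.exists_comap_eq f g a b hb.symm
  obtain ⟨q, rfl⟩ := h t
  obtain ⟨z, q, rfl⟩ := exists_comap_evalRingHom_eq q
  refine ⟨z, q, ?_⟩
  simp only [← comap_comp_apply]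
  congr 1
  ext r
  simp

/-- The converse needs epimorphisms: a prime of `A ⊗_R B` is then determined by its image in `Spec
R`, so it suffices to hit that image. -/
theorem Tens.surjective_comap_of_exists_mem_range (hf : f.IsEpic) (hg : g.IsEpic)
    (e : (RingHom.pi α).comp f = (RingHom.pi β).comp g)
    (h : ∀ p : PrimeSpectrum R, p ∈ Set.range (comap f) → p ∈ Set.range (comap g) →
      ∃ z, p ∈ Set.range (comap ((α z).comp f))) :
    Function.Surjective (comap (Tens.lift (RingHom.pi α) (RingHom.pi β) e)) := by
  intro t
  obtain ⟨z, q, hq⟩ := h (comap ((Tens.inl f g).comp f) t) ⟨comap (Tens.inl f g) t, rfl⟩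
    ⟨comap (Tens.inr f g) t, by rw [← comap_comp_apply, Tens.inl_comp]⟩
  refine ⟨comap (Pi.evalRingHom O z) q, (hf.inl_comp hg).comap_injective ?_⟩
  rw [← hq]
  simp only [← comap_comp_apply]
  congr 1
  ext r
  simp

end TensToPi

/-! ### Schematic spaces and morphisms in terms of primes -/

namespace RingedPoset

open PrimeSpectrum

variable {X Y : RingedPoset.{u}}

theorem IsSchematic.flat (hX : X.IsSchematic) {x y : X} (h : x ≤ y) : (X.res h).Flat :=
  hX.1 x y h

/-- Case of the pair `(y, y)` over `x`: a faithfully flat map is injective, and `s ⊗ 1` and `1 ⊗ s`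
have the same image in the product. -/
theorem IsSchematic.isEpic (hX : X.IsSchematic) {x y : X} (h : x ≤ y) : (X.res h).IsEpic := by
  refine RingHom.IsEpic.of_inl_eq_inr (RingHom.ext fun s => (hX.2 x y y h h).injective ?_)
  simp [tensorToProd]

theorem IsSchematic.exists_mem_range (hX : X.IsSchematic) {t x y : X} (hx : t ≤ x) (hy : t ≤ y)
    {p : PrimeSpectrum (X.stalk t)} (hp : p ∈ Set.range (comap (X.res hx)))
    (hp' : p ∈ Set.range (comap (X.res hy))) :
    ∃ (z : X) (hxz : x ≤ z) (_ : y ≤ z), p ∈ Set.range (comap (X.res (hx.trans hxz))) := by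
  obtain ⟨z, hz⟩ := Tens.exists_mem_range_of_surjective_comap _
    (RingHom.FaithfullyFlat.iff_flat_and_comap_surjective.1 (hX.2 t x y hx hy)).2 hp hp'
  refine ⟨z.1, z.2.1, z.2.2, ?_⟩
  convert hz using 3
  ext s
  exact (X.res_res _ _ s).symm

/-- A finite ringed poset is schematic if its restrictions are flat epimorphisms and the images of
the spectra satisfy `Spec 𝒪_x ∩ Spec 𝒪_y ⊆ ⋃_{z ≥ x, y} Spec 𝒪_z` in `Spec 𝒪_t` for `t ≤ x, y`. -/
theorem isSchematic_of_exists_mem_range (hflat : ∀ (x y : X) (h : x ≤ y), (X.res h).Flat)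
    (hepi : ∀ (x y : X) (h : x ≤ y), (X.res h).IsEpic)
    (H : ∀ (t x y : X) (hx : t ≤ x) (hy : t ≤ y) (p : PrimeSpectrum (X.stalk t)),
      p ∈ Set.range (comap (X.res hx)) → p ∈ Set.range (comap (X.res hy)) →
      ∃ (z : X) (hxz : x ≤ z) (_ : y ≤ z), p ∈ Set.range (comap (X.res (hx.trans hxz)))) :
    X.IsSchematic := by
  refine ⟨hflat, fun t x y hx hy =>
    RingHom.FaithfullyFlat.iff_flat_and_comap_surjective.2 ⟨?_, ?_⟩⟩
  · refine Tens.flat_lift_pi (hepi _ _ _) (hepi _ _ _) _ fun z => ?_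
    convert hflat t z.1 (hx.trans z.2.1) using 1
    ext s
    exact X.res_res _ _ s
  · refine Tens.surjective_comap_of_exists_mem_range (hepi _ _ _) (hepi _ _ _) _ fun p hp hp' => ?_
    obtain ⟨z, hxz, hyz, h⟩ := H t x y hx hy p hp hp'
    refine ⟨⟨z, hxz, hyz⟩, ?_⟩
    convert h using 3
    ext s
    exact X.res_res _ _ s

theorem Hom.IsSchematic.exists_mem_range {f : Hom X Y} (hf : f.IsSchematic) {x : X} {y : Y}
    (h : f x ≤ y) {p : PrimeSpectrum (Y.stalk (f x))} (hp : p ∈ Set.range (comap (f.sharp x)))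
    (hp' : p ∈ Set.range (comap (Y.res h))) :
    ∃ (z : X) (hxz : x ≤ z) (_ : y ≤ f z),
      p ∈ Set.range (comap ((X.res hxz).comp (f.sharp x))) := by
  obtain ⟨z, hz⟩ := Tens.exists_mem_range_of_surjective_comap _ (hf x y h) hp hp'
  exact ⟨z.1, z.2.1, z.2.2, hz⟩

theorem Hom.isSchematic_of_exists_mem_range {f : Hom X Y} (hf : ∀ x, (f.sharp x).IsEpic)
    (hY : ∀ (x y : Y) (h : x ≤ y), (Y.res h).IsEpic)
    (H : ∀ (x : X) (y : Y) (h : f x ≤ y) (p : PrimeSpectrum (Y.stalk (f x))),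
      p ∈ Set.range (comap (f.sharp x)) → p ∈ Set.range (comap (Y.res h)) →
      ∃ (z : X) (hxz : x ≤ z) (_ : y ≤ f z),
        p ∈ Set.range (comap ((X.res hxz).comp (f.sharp x)))) : f.IsSchematic := by
  intro x y h
  refine Tens.surjective_comap_of_exists_mem_range (hf x) (hY _ _ _) _ fun p hp hp' => ?_
  obtain ⟨z, hxz, hyz, hz⟩ := H x y h p hp hp'
  exact ⟨⟨z, hxz, hyz⟩, hz⟩

/-- The diagonal sends `s ⊗ 1` and `1 ⊗ s` at `(x, x)` to the same section, and its structure map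
there is injective. -/
theorem Hom.IsFlatImmersion.isEpic {f : Hom X Y} (hf : f.IsFlatImmersion) (x : X) :
    (f.sharp x).IsEpic := by
  have hinj := (hf.2.2 ⟨(x, x), rfl⟩).1
  have e : Tens.inl (f.sharp x) ((f.sharp x).comp (Y.res le_rfl)) =
      Tens.inr (f.sharp x) ((f.sharp x).comp (Y.res le_rfl)) := by
    refine RingHom.ext fun s => hinj (Subtype.ext (funext fun z => ?_))
    have h : (⟨(x, x), rfl⟩ : fiberProd f f) ≤ f.diagonal z.1 := z.2
    change (f.diagonal.sharp z.1) ((fiberProd f f).res h _) =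
      (f.diagonal.sharp z.1) ((fiberProd f f).res h _)
    rw [fiberProd_res_inl f f h h.1, fiberProd_res_inr f f h h.2]
    have aux := fiberLift_aux (f := f) (g := f) (Hom.id X) (Hom.id X) rfl z.1
    exact (Tens.lift_inl _ _ aux (X.res h.1 s)).trans (Tens.lift_inr _ _ aux (X.res h.2 s)).symm
  intro C _ a b hab
  -- The second leg of the stalk of a fibered product carries a restriction along `f x ≤ f x`, which
  -- is the identity.
  have h' : a.comp (f.sharp x) = b.comp ((f.sharp x).comp (Y.res le_rfl)) := by
    rw [hab]
    ext s
    simp [Y.res_refl]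
  have h1 : (Tens.lift a b h').comp (Tens.inl _ _) = a :=
    RingHom.ext fun s => Tens.lift_inl a b h' s
  have h2 : (Tens.lift a b h').comp (Tens.inr _ _) = b :=
    RingHom.ext fun s => Tens.lift_inr a b h' s
  rw [← h1, e, h2]

end RingedPoset

/-! ### Semilinear base change and detection of zero -/

section IsBC

variable {R S T : Type u} [CommRing R] [CommRing S] [CommRing T]
  {M N P : Type u} [AddCommGroup M] [AddCommGroup N] [AddCommGroup P]

/-- A semilinear map `φ : M → N` over `f : R → S` exhibiting `N` as `S ⊗_R M`. -/
def IsBC [Module R M] [Module S N] (f : R →+* S) (φ : M →ₛₗ[f] N) : Prop :=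
  Function.Bijective (ScalarExt.lift φ)

/-- A semilinear map as a linear map for the restricted scalars. -/
def LinearMap.toCompHom [Module R M] [Module S N] {f : R →+* S} (φ : M →ₛₗ[f] N) :
    letI : Module R N := Module.compHom N f
    M →ₗ[R] N :=
  letI : Module R N := Module.compHom N f
  { φ with map_smul' := fun r m => φ.map_smulₛₗ r m }

theorem isBC_iff_isBaseChange [Module R M] [Module S N] {f : R →+* S} (φ : M →ₛₗ[f] N) :
    IsBC f φ ↔
      letI := f.toAlgebra
      letI : Module R N := Module.compHom N f
      haveI : IsScalarTower R S N := ⟨fun r s n => mul_smul (f r) s n⟩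
      IsBaseChange S φ.toCompHom := by
  letI := f.toAlgebra
  letI : Module R N := Module.compHom N f
  haveI : IsScalarTower R S N := ⟨fun r s n => mul_smul (f r) s n⟩
  rfl

namespace IsBC

theorem unit [Module R M] (f : R →+* S) : IsBC f (ScalarExt.unit f M) := by
  have : ScalarExt.lift (ScalarExt.unit f M) = LinearMap.id := by
    ext x
    refine ScalarExt.induction_on x (fun s m => ?_) (fun x y hx hy => ?_)
    · rw [map_smul, ScalarExt.lift_unit]
      rfl
    · rw [map_add, hx, hy, map_add]
  rw [IsBC, this]
  exact Function.bijective_id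

theorem of_comp [Module R M] [Module S N] [Module T P] {f : R →+* S} {g : S →+* T} {h : R →+* T}
    (e : g.comp f = h) {φ : M →ₛₗ[f] N} {ψ : N →ₛₗ[g] P} {χ : M →ₛₗ[h] P}
    (hc : ∀ m, ψ (φ m) = χ m) (hφ : IsBC f φ) (hχ : IsBC h χ) : IsBC g ψ := by
  subst e
  letI := f.toAlgebra
  letI := g.toAlgebra
  letI := (g.comp f).toAlgebra
  haveI : IsScalarTower R S T := IsScalarTower.of_algebraMap_eq fun _ => rfl
  letI : Module R N := Module.compHom N f
  haveI : IsScalarTower R S N := ⟨fun r s n => mul_smul (f r) s n⟩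
  letI : Module S P := Module.compHom P g
  haveI : IsScalarTower S T P := ⟨fun r s n => mul_smul (g r) s n⟩
  letI : Module R P := Module.compHom P (g.comp f)
  haveI : IsScalarTower R T P := ⟨fun r s n => mul_smul (g (f r)) s n⟩
  haveI : IsScalarTower R S P := ⟨fun r s n => by
    change g (f r * s) • n = g (f r) • g s • n
    rw [map_mul, mul_smul]⟩
  rw [isBC_iff_isBaseChange] at hφ hχ ⊢
  refine IsBaseChange.of_comp (f := φ.toCompHom) hφ ?_
  convert hχ using 1
  ext m
  exact hc m

/-- If `φ m = 0` for a flat base change `φ`, then no prime of `S` contains the annihilator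
of `m`. -/
theorem exists_smul_eq_zero [Module R M] [Module S N] {f : R →+* S} (hf : f.Flat)
    {φ : M →ₛₗ[f] N} (hφ : IsBC f φ) {m : M} (hm : φ m = 0) (q : PrimeSpectrum S) :
    ∃ r : R, r • m = 0 ∧ f r ∉ q.asIdeal := by
  by_contra! H
  letI := f.toAlgebra
  haveI : Module.Flat R S := hf
  -- `J` is the annihilator of `m`. By flatness, `R ⧸ J ↪ M` stays injective after tensoring with
  -- `S`, so `1 ⊗ m = 0` forces `S ⊗ R ⧸ J` to have zero unit.
  let J := LinearMap.ker (LinearMap.toSpanSingleton R M m)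
  let ι : (R ⧸ J) →ₗ[R] M := J.liftQ (LinearMap.toSpanSingleton R M m) le_rfl
  have hι : Function.Injective ι := LinearMap.ker_eq_bot.1 (Submodule.ker_liftQ_eq_bot' _ _ rfl)
  have h1 : ((1 : S) ⊗ₜ[R] m : TensorProduct R S M) = 0 :=
    hφ.1 (((ScalarExt.lift_unit φ m).trans hm).trans (map_zero (ScalarExt.lift φ)).symm)
  have h2 : ((1 : S) ⊗ₜ[R] (J.mkQ 1) : TensorProduct R S (R ⧸ J)) = 0 := by
    apply Module.Flat.lTensor_preserves_injective_linearMap (M := S) ι hι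
    rw [map_zero, LinearMap.lTensor_tmul, ← h1]
    congr 1
    exact (Submodule.liftQ_apply _ _ _).trans (one_smul R m)
  -- If `J` mapped into `q`, then `S ⊗ R ⧸ J` would map to `S ⧸ q` with unit going to `1 ≠ 0`.
  let π : (R ⧸ J) →ₗ[R] (S ⧸ q.asIdeal) :=
    J.liftQ ((Algebra.linearMap R (S ⧸ q.asIdeal))) (by
      intro r hr
      have : f r ∈ q.asIdeal := H r (by simpa [J] using hr)
      exact Ideal.Quotient.eq_zero_iff_mem.2 this)
  let β : TensorProduct R S (R ⧸ J) →ₗ[R] (S ⧸ q.asIdeal) :=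
    TensorProduct.lift (((LinearMap.mul R (S ⧸ q.asIdeal)).comp
      (IsScalarTower.toAlgHom R S (S ⧸ q.asIdeal)).toLinearMap).compl₂ π)
  have h3 : β ((1 : S) ⊗ₜ[R] (J.mkQ 1)) = 1 := by
    have hπ : π (J.mkQ 1) = 1 := (Submodule.liftQ_apply _ _ _).trans (map_one (algebraMap R _))
    change (IsScalarTower.toAlgHom R S (S ⧸ q.asIdeal) 1) * π (J.mkQ 1) = 1
    rw [hπ, map_one, mul_one]
  rw [h2, map_zero] at h3
  exact q.2.ne_top ((Ideal.Quotient.subsingleton_iff).1 (subsingleton_of_zero_eq_one h3))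

/-- Flat base changes that cover the spectrum detect zero. -/
theorem eq_zero_of_forall_eq_zero [Module R M] {ι : Type*} {B : ι → Type u}
    [∀ i, CommRing (B i)] {Q : ι → Type u} [∀ i, AddCommGroup (Q i)] [∀ i, Module (B i) (Q i)]
    {f : ∀ i, R →+* B i} (hf : ∀ i, (f i).Flat)
    (hcov : ∀ p : PrimeSpectrum R, ∃ i, p ∈ Set.range (PrimeSpectrum.comap (f i)))
    {φ : ∀ i, M →ₛₗ[f i] Q i} (hφ : ∀ i, IsBC (f i) (φ i)) {m : M} (hm : ∀ i, φ i m = 0) :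
    m = 0 := by
  by_contra hne
  let J := LinearMap.ker (LinearMap.toSpanSingleton R M m)
  have hJ : J ≠ ⊤ := fun h => hne (by
    have : (1 : R) ∈ J := h ▸ Submodule.mem_top
    simpa [J] using this)
  -- A maximal ideal containing the annihilator is the image of a prime `q` of some `B i`; yet some
  -- element of the annihilator lies outside `q`.
  obtain ⟨p, hp, hle⟩ := Ideal.exists_le_maximal J hJ
  obtain ⟨i, q, hq⟩ := hcov ⟨p, hp.isPrime⟩
  obtain ⟨r, hr, hr'⟩ := (hφ i).exists_smul_eq_zero (hf i) (hm i) q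
  refine hr' ?_
  have : r ∈ (PrimeSpectrum.comap (f i) q).asIdeal := by
    rw [hq]
    exact hle (by simpa [J] using hr)
  exact this

end IsBC

end IsBC

/-! ### Base change of finite limits and along pushouts of rings -/

section Limits

/-- Flat base change commutes with finite limits. -/
theorem isBaseChange_limit {A S : Type u} [CommRing A] [CommRing S] [Algebra A S]
    [Module.Flat A S] {I : Type u} [Finite I] [LE I] {N N' : I → Type u}
    [∀ i, AddCommGroup (N i)] [∀ i, AddCommGroup (N' i)] [∀ i, Module A (N i)]
    [∀ i, Module A (N' i)] [∀ i, Module S (N' i)] [∀ i, IsScalarTower A S (N' i)]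
    (r : ∀ {i j : I}, i ≤ j → N i →ₗ[A] N j) (r' : ∀ {i j : I}, i ≤ j → N' i →ₗ[S] N' j)
    (v : ∀ i, N i →ₗ[A] N' i) (hv : ∀ i, IsBaseChange S (v i))
    (hr : ∀ {i j : I} (h : i ≤ j) (n : N i), v j (r h n) = r' h (v i n))
    {Γ Γ' : Type u} [AddCommGroup Γ] [AddCommGroup Γ'] [Module A Γ] [Module A Γ'] [Module S Γ']
    [IsScalarTower A S Γ'] (p : Γ →ₗ[A] ∀ i, N i) (p' : Γ' →ₗ[S] ∀ i, N' i)
    (hp : Function.Injective p) (hp' : Function.Injective p')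
    (hpr : ∀ n, n ∈ Set.range p ↔ ∀ i j (h : i ≤ j), r h (n i) = n j)
    (hpr' : ∀ n, n ∈ Set.range p' ↔ ∀ i j (h : i ≤ j), r' h (n i) = n j)
    (u : Γ →ₗ[A] Γ') (hu : ∀ γ i, p' (u γ) i = v i (p γ i)) : IsBaseChange S u := by
  -- The limit is the kernel of the difference map between the finite products over `I` and over its
  -- pairs `i ≤ j`; flat base change preserves this left exact sequence.
  let E := {e : I × I // e.1 ≤ e.2}
  let g : (∀ i, N i) →ₗ[A] ∀ e : E, N e.1.2 :=
    LinearMap.pi fun e => (r e.2) ∘ₗ LinearMap.proj e.1.1 - LinearMap.proj e.1.2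
  let g' : (∀ i, N' i) →ₗ[S] ∀ e : E, N' e.1.2 :=
    LinearMap.pi fun e => (r' e.2) ∘ₗ LinearMap.proj e.1.1 - LinearMap.proj e.1.2
  refine IsBaseChange.of_left_exact S u _ _ (f := p) (g := g) (f' := p') (g' := g') ?_ ?_
    (IsBaseChange.pi v hv) (IsBaseChange.pi (fun e : E => v e.1.2) fun e => hv _) ?_ hp ?_ hp'
  · ext γ i
    exact (hu γ i).symm
  · refine LinearMap.ext fun n => funext fun e => ?_
    simp [g, g', hr]
  · intro n
    rw [hpr]
    constructor
    · intro h i j hij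
      exact sub_eq_zero.1 (congrFun h ⟨(i, j), hij⟩)
    · exact fun h => funext fun e => sub_eq_zero.2 (h _ _ e.2)
  · intro n
    rw [hpr']
    constructor
    · intro h i j hij
      exact sub_eq_zero.1 (congrFun h ⟨(i, j), hij⟩)
    · exact fun h => funext fun e => sub_eq_zero.2 (h _ _ e.2)

end Limits

section Pushout

variable {A B S : Type u} [CommRing A] [CommRing B] [CommRing S] (f : A →+* B) (g : A →+* S)

theorem Tens.isPushout :
    letI := f.toAlgebra
    letI := g.toAlgebra
    letI := (Tens.inl f g).toAlgebra
    letI := (Tens.inr f g).toAlgebra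
    letI := ((Tens.inl f g).comp f).toAlgebra
    haveI : IsScalarTower A B (Tens f g) := IsScalarTower.of_algebraMap_eq fun _ => rfl
    haveI : IsScalarTower A S (Tens f g) :=
      IsScalarTower.of_algebraMap_eq (RingHom.congr_fun (Tens.inl_comp f g))
    Algebra.IsPushout A S B (Tens f g) := by
  letI := f.toAlgebra
  letI := g.toAlgebra
  letI := (Tens.inl f g).toAlgebra
  letI := (Tens.inr f g).toAlgebra
  letI := ((Tens.inl f g).comp f).toAlgebra
  haveI : IsScalarTower A B (Tens f g) := IsScalarTower.of_algebraMap_eq fun _ => rfl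
  haveI : IsScalarTower A S (Tens f g) :=
    IsScalarTower.of_algebraMap_eq (RingHom.congr_fun (Tens.inl_comp f g))
  refine Algebra.IsPushout.symm ⟨?_⟩
  -- The comparison map defining a base change is here the identity of `B ⊗_A S`.
  have h : ∀ x : TensorProduct A B S, TensorProduct.lift
      (((Algebra.linearMap B <| Module.End B (S →ₗ[A] Tens f g)).flip
        (IsScalarTower.toAlgHom A S (Tens f g)).toLinearMap).restrictScalars A) x =
      (show Tens f g from x) := by
    intro x
    induction x using TensorProduct.induction_on with
    | zero => exact map_zero _
    | tmul b s =>
      change (b ⊗ₜ[A] (1 : S) : TensorProduct A B S) * ((1 : B) ⊗ₜ[A] s) = b ⊗ₜ[A] s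
      rw [Algebra.TensorProduct.tmul_mul_tmul, mul_one, one_mul]
    | add x y hx hy => exact (map_add _ x y).trans (congrArg₂ (· + ·) hx hy)
  exact ⟨fun x y e => (h x).symm.trans (e.trans (h y)), fun y => ⟨y, h y⟩⟩

end Pushout

namespace ScalarExt

variable {R S T : Type u} [CommRing R] [CommRing S] [CommRing T]
  {M P : Type u} [AddCommGroup M] [AddCommGroup P] [Module R M] [Module T P]
  {f : R →+* S} {g : R →+* T}

/-- The map `s ⊗ m ↦ h s • φ m`. -/
def desc (h : S →+* T) (e : h.comp f = g) (φ : M →ₛₗ[g] P) : ScalarExt f M →ₛₗ[h] P :=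
  (lift φ).comp (map h e M)

@[simp]
theorem desc_unit (h : S →+* T) (e : h.comp f = g) (φ : M →ₛₗ[g] P) (m : M) :
    desc h e φ (unit f M m) = φ m :=
  (congrArg (lift φ) (map_unit h e m)).trans (lift_unit φ m)

theorem isBC_desc (h : S →+* T) (e : h.comp f = g) {φ : M →ₛₗ[g] P} (hφ : IsBC g φ) :
    IsBC h (desc h e φ) :=
  IsBC.of_comp e (fun m => desc_unit h e φ m) (IsBC.unit f) hφ

end ScalarExt

/-- Cancellation `(B ⊗_A S) ⊗_B M ≃ S ⊗_A M`. The map `v` is given by its values, so that it can be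
any linear map built from the unit. -/
theorem ScalarExt.isBaseChange_pushout {A B S M : Type u} [CommRing A] [CommRing B] [CommRing S]
    [AddCommGroup M] [Module B M] (f : A →+* B) (g : A →+* S) :
    letI := g.toAlgebra
    letI : Module A M := Module.compHom M f
    letI : Module A (ScalarExt (Tens.inl f g) M) := Module.compHom _ ((Tens.inl f g).comp f)
    letI : Module S (ScalarExt (Tens.inl f g) M) := Module.compHom _ (Tens.inr f g)
    ∀ (_ : IsScalarTower A S (ScalarExt (Tens.inl f g) M))
      (v : M →ₗ[A] ScalarExt (Tens.inl f g) M),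
      (∀ m, v m = ScalarExt.unit (Tens.inl f g) M m) → IsBaseChange S v := by
  letI := f.toAlgebra
  letI := g.toAlgebra
  letI := (Tens.inl f g).toAlgebra
  letI := (Tens.inr f g).toAlgebra
  letI := ((Tens.inl f g).comp f).toAlgebra
  letI : Module A M := Module.compHom M f
  haveI : IsScalarTower A B M := ⟨fun r s n => mul_smul (f r) s n⟩
  haveI : IsScalarTower A B (Tens f g) := IsScalarTower.of_algebraMap_eq fun _ => rfl
  haveI : IsScalarTower A S (Tens f g) :=
    IsScalarTower.of_algebraMap_eq (RingHom.congr_fun (Tens.inl_comp f g))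
  letI : Module A (ScalarExt (Tens.inl f g) M) := Module.compHom _ ((Tens.inl f g).comp f)
  letI : Module S (ScalarExt (Tens.inl f g) M) := Module.compHom _ (Tens.inr f g)
  intro _ v hv
  haveI := Tens.isPushout f g
  refine IsBaseChange.of_equiv (Algebra.IsPushout.cancelBaseChange A S B (Tens f g) M).symm ?_
  intro m
  rw [hv]
  exact (Algebra.IsPushout.cancelBaseChange_symm_tmul A S B (Tens f g) M 1 m).trans
    (congrArg (fun t : Tens f g => (t ⊗ₜ[B] m : TensorProduct B (Tens f g) M))
      (map_one (Tens.inr f g)))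

/-! ### Affine covers of a ring by the stalks of a ringed poset -/

namespace RingedPoset

open PrimeSpectrum

variable {X : RingedPoset.{u}} {A : Type u} [CommRing A]

/-- `Spec A` is covered by the `Spec 𝒪_x`, which are flat monomorphisms, and the intersections
`Spec 𝒪_x ∩ Spec 𝒪_y` are covered by the `Spec 𝒪_z` with `z ≥ x, y`. -/
structure IsAffineCover (X : RingedPoset.{u}) (f : ∀ x : X, A →+* X.stalk x) : Prop where
  comp : ∀ {x y : X} (h : x ≤ y), (X.res h).comp (f x) = f y
  flat : ∀ x, (f x).Flat
  epi : ∀ x, (f x).IsEpic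
  cover : ∀ p : PrimeSpectrum A, ∃ x, p ∈ Set.range (comap (f x))
  inter : ∀ (p : PrimeSpectrum A) (x y : X), p ∈ Set.range (comap (f x)) →
    p ∈ Set.range (comap (f y)) → ∃ z, x ≤ z ∧ y ≤ z ∧ p ∈ Set.range (comap (f z))

/-- The module `Γ` is the limit of the stalks of `N`. -/
structure IsLimit (N : SheafModule X) {Γ : Type u} (p : ∀ x, Γ → N.stalk x) : Prop where
  res : ∀ {x y : X} (h : x ≤ y) (γ : Γ), N.res h (p x γ) = p y γ
  ext : ∀ {γ γ' : Γ}, (∀ x, p x γ = p x γ') → γ = γ'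
  exists_of_res : ∀ n : ∀ x, N.stalk x, (∀ x y (h : x ≤ y), N.res h (n x) = n y) →
    ∃ γ, ∀ x, p x γ = n x

variable {f : ∀ x : X, A →+* X.stalk x}

theorem IsAffineCover.toTens_comm (hf : X.IsAffineCover f) {z x w : X} (hz : z ≤ w)
    (hx : x ≤ w) : (X.res hz).comp (f z) = (X.res hx).comp (f x) :=
  (hf.comp hz).trans (hf.comp hx).symm

/-- The map `𝒪_z ⊗_A 𝒪_x → 𝒪_w` for `z, x ≤ w`. -/
def IsAffineCover.toTens (hf : X.IsAffineCover f) {z x w : X} (hz : z ≤ w) (hx : x ≤ w) :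
    Tens (f z) (f x) →+* X.stalk w :=
  Tens.lift (X.res hz) (X.res hx) (hf.toTens_comm hz hx)

theorem IsAffineCover.toTens_comp_inl (hf : X.IsAffineCover f) {z x w : X} (hz : z ≤ w)
    (hx : x ≤ w) : (hf.toTens hz hx).comp (Tens.inl _ _) = X.res hz :=
  RingHom.ext fun s => Tens.lift_inl _ _ (hf.toTens_comm hz hx) s

theorem IsAffineCover.toTens_comp_inr (hf : X.IsAffineCover f) {z x w : X} (hz : z ≤ w)
    (hx : x ≤ w) : (hf.toTens hz hx).comp (Tens.inr _ _) = X.res hx :=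
  RingHom.ext fun s => Tens.lift_inr _ _ (hf.toTens_comm hz hx) s

theorem IsAffineCover.res_comp_toTens (hf : X.IsAffineCover f) {z x w w' : X} (hz : z ≤ w)
    (hx : x ≤ w) (h : w ≤ w') :
    (X.res h).comp (hf.toTens hz hx) = hf.toTens (hz.trans h) (hx.trans h) := by
  refine Tens.hom_ext ?_ ?_
  · rw [RingHom.comp_assoc, hf.toTens_comp_inl, hf.toTens_comp_inl]
    exact RingHom.ext fun s => X.res_res hz h s
  · rw [RingHom.comp_assoc, hf.toTens_comp_inr, hf.toTens_comp_inr]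
    exact RingHom.ext fun s => X.res_res hx h s

theorem IsAffineCover.toTens_comp (hf : X.IsAffineCover f) {z x w : X} (hz : z ≤ w)
    (hx : x ≤ w) : (hf.toTens hz hx).comp ((Tens.inl _ _).comp (f z)) = f w := by
  rw [← RingHom.comp_assoc, hf.toTens_comp_inl, hf.comp]

theorem IsAffineCover.flat_toTens (hf : X.IsAffineCover f) {z x w : X} (hz : z ≤ w)
    (hx : x ≤ w) : (hf.toTens hz hx).Flat :=
  ((hf.epi z).inl_comp (hf.epi x)).flat_of_comp (by rw [hf.toTens_comp]; exact hf.flat w)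

theorem IsAffineCover.isEpic_toTens (hf : X.IsAffineCover f) {z x w : X} (hz : z ≤ w)
    (hx : x ≤ w) : (hf.toTens hz hx).IsEpic :=
  RingHom.IsEpic.of_comp (f := (Tens.inl _ _).comp (f z))
    (by rw [hf.toTens_comp]; exact hf.epi w)

/-- As `A → 𝒪_z ⊗_A 𝒪_x` is injective on spectra, all incidence questions on the overlap are settled
in `Spec A`. -/
theorem IsAffineCover.mem_range_toTens_iff (hf : X.IsAffineCover f) {z x w : X} (hz : z ≤ w)
    (hx : x ≤ w) (p : PrimeSpectrum (Tens (f z) (f x))) :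
    p ∈ Set.range (comap (hf.toTens hz hx)) ↔
      comap ((Tens.inl _ _).comp (f z)) p ∈ Set.range (comap (f w)) := by
  constructor
  · rintro ⟨q, rfl⟩
    exact ⟨q, by rw [← comap_comp_apply, hf.toTens_comp]⟩
  · rintro ⟨q, hq⟩
    exact ⟨q, ((hf.epi z).inl_comp (hf.epi x)).comap_injective
      (by rw [← hq, ← comap_comp_apply, hf.toTens_comp])⟩

/-- The points `w ≥ z, x` cover the spectrum of `𝒪_z ⊗_A 𝒪_x`. -/
theorem IsAffineCover.tens (hf : X.IsAffineCover f) (z x : X) :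
    (X.restrict {w | z ≤ w ∧ x ≤ w}).IsAffineCover (fun w => hf.toTens w.2.1 w.2.2) where
  comp := fun {w _} h => hf.res_comp_toTens w.2.1 w.2.2 h
  flat := fun w => hf.flat_toTens w.2.1 w.2.2
  epi := fun w => hf.isEpic_toTens w.2.1 w.2.2
  cover := fun p => by
    obtain ⟨w, hz, hx, hw⟩ := hf.inter (comap ((Tens.inl _ _).comp (f z)) p) z x
      ⟨comap (Tens.inl _ _) p, rfl⟩ ⟨comap (Tens.inr _ _) p, by rw [Tens.inl_comp]; rfl⟩
    exact ⟨⟨w, hz, hx⟩, (hf.mem_range_toTens_iff hz hx p).2 hw⟩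
  inter := fun p w w' hw hw' => by
    obtain ⟨k, hk, hk', h⟩ := hf.inter _ w.1 w'.1
      ((hf.mem_range_toTens_iff w.2.1 w.2.2 p).1 hw)
      ((hf.mem_range_toTens_iff w'.2.1 w'.2.2 p).1 hw')
    exact ⟨⟨k, w.2.1.trans hk, w.2.2.trans hk⟩, hk, hk', (hf.mem_range_toTens_iff _ _ p).2 h⟩

/-! ### Descent along an affine cover -/

/-- The restriction of a sheaf of modules to a subset. -/
def SheafModule.restrict (N : SheafModule X) (U : Set X) :
    SheafModule (X.restrict U) where
  stalk := fun x => N.stalk x.1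
  group := fun x => N.group x.1
  module := fun x => N.module x.1
  res := fun h => N.res h
  res_refl := fun x => N.res_refl x.1
  res_res := fun h k => N.res_res h k

variable {N : SheafModule X}

/-- The stalk at `z` of the base change of `N` along `A → 𝒪_x`. -/
abbrev tensStalk (f : ∀ x : X, A →+* X.stalk x) (N : SheafModule X) (z x : X) : Type u :=
  ScalarExt (Tens.inl (f z) (f x)) (N.stalk z)

/-- The map from the base change of `N` along `A → 𝒪_x` at `z` to `N_w` for `w ≥ z, x`. -/
def IsAffineCover.tensRes (hf : X.IsAffineCover f) (N : SheafModule X) {z x w : X} (hz : z ≤ w)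
    (hx : x ≤ w) : tensStalk f N z x →ₛₗ[hf.toTens hz hx] N.stalk w :=
  ScalarExt.desc (hf.toTens hz hx) (hf.toTens_comp_inl hz hx) (N.res hz)

theorem IsAffineCover.isBC_tensRes (hf : X.IsAffineCover f) (hN : N.IsQuasicoherent) {z x w : X}
    (hz : z ≤ w) (hx : x ≤ w) : IsBC (hf.toTens hz hx) (hf.tensRes N hz hx) :=
  ScalarExt.isBC_desc _ _ (hN z w hz)

/-- For quasi-coherent `N`, the `N_w` with `w ≥ z, x` are base changes of this module along a flat
cover of `𝒪_z ⊗_A 𝒪_x`, so they detect zero. -/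
theorem IsAffineCover.tensStalk_ext (hf : X.IsAffineCover f) (hN : N.IsQuasicoherent) {z x : X}
    {m m' : tensStalk f N z x}
    (h : ∀ (w : X) (hz : z ≤ w) (hx : x ≤ w), hf.tensRes N hz hx m = hf.tensRes N hz hx m') :
    m = m' := by
  refine sub_eq_zero.1 (IsBC.eq_zero_of_forall_eq_zero (hf.tens z x).flat (hf.tens z x).cover
    (φ := fun w : {w | z ≤ w ∧ x ≤ w} => hf.tensRes N w.2.1 w.2.2)
    (fun w => hf.isBC_tensRes hN w.2.1 w.2.2) fun w => ?_)
  rw [map_sub, h, sub_self]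

/-- The map `𝒪_z ⊗_A 𝒪_x → 𝒪_z' ⊗_A 𝒪_x` for `z ≤ z'`. -/
def IsAffineCover.tensTransRing (hf : X.IsAffineCover f) {z z' : X} (h : z ≤ z') (x : X) :
    Tens (f z) (f x) →+* Tens (f z') (f x) :=
  Tens.lift ((Tens.inl _ _).comp (X.res h)) (Tens.inr _ _) (by
    rw [RingHom.comp_assoc, hf.comp, Tens.inl_comp])

theorem IsAffineCover.tensTransRing_comp_inl (hf : X.IsAffineCover f) {z z' : X} (h : z ≤ z')
    (x : X) : (hf.tensTransRing h x).comp (Tens.inl _ _) = (Tens.inl _ _).comp (X.res h) :=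
  RingHom.ext fun s => Tens.lift_inl _ _ (by rw [RingHom.comp_assoc, hf.comp, Tens.inl_comp]) s

theorem IsAffineCover.tensTransRing_comp_inr (hf : X.IsAffineCover f) {z z' : X} (h : z ≤ z')
    (x : X) : (hf.tensTransRing h x).comp (Tens.inr _ _) = Tens.inr _ _ :=
  RingHom.ext fun s => Tens.lift_inr _ _ (by rw [RingHom.comp_assoc, hf.comp, Tens.inl_comp]) s

/-- The restrictions of the base change of `N` along `A → 𝒪_x`. -/
def IsAffineCover.tensTrans (hf : X.IsAffineCover f) (N : SheafModule X) {z z' : X} (h : z ≤ z')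
    (x : X) : tensStalk f N z x →ₛₗ[hf.tensTransRing h x] tensStalk f N z' x :=
  ScalarExt.desc (hf.tensTransRing h x) (hf.tensTransRing_comp_inl h x)
    (haveI : RingHomCompTriple (X.res h) (Tens.inl (f z') (f x))
      ((Tens.inl (f z') (f x)).comp (X.res h)) := ⟨rfl⟩
    (ScalarExt.unit (Tens.inl (f z') (f x)) (N.stalk z')).comp (N.res h))

theorem IsAffineCover.tensRes_tensTrans (hf : X.IsAffineCover f) {z z' x w : X} (h : z ≤ z')
    (hz : z' ≤ w) (hx : x ≤ w) (m : tensStalk f N z x) :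
    hf.tensRes N hz hx (hf.tensTrans N h x m) = hf.tensRes N (h.trans hz) hx m := by
  refine ScalarExt.induction_on m (fun s n => ?_) (fun a b ha hb => ?_)
  · rw [LinearMap.map_smulₛₗ, LinearMap.map_smulₛₗ, LinearMap.map_smulₛₗ]
    congr 1
    · rw [← RingHom.comp_apply]
      refine RingHom.congr_fun (Tens.hom_ext ?_ ?_) s
      · rw [RingHom.comp_assoc, hf.tensTransRing_comp_inl, ← RingHom.comp_assoc,
          hf.toTens_comp_inl, hf.toTens_comp_inl]
        exact RingHom.ext fun s => X.res_res h hz s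
      · rw [RingHom.comp_assoc, hf.tensTransRing_comp_inr, hf.toTens_comp_inr, hf.toTens_comp_inr]
    · refine ((congrArg (hf.tensRes N hz hx) (ScalarExt.desc_unit _ _ _ n)).trans
        (ScalarExt.desc_unit _ _ _ _)).trans ?_
      exact (N.res_res h hz n).trans (ScalarExt.desc_unit _ _ _ n).symm
  · simp only [map_add, ha, hb]

end RingedPoset

theorem ScalarExt.mul_smul {R S M : Type u} [CommRing R] [CommRing S] [AddCommGroup M]
    [Module R M] (f : R →+* S) (a b : S) (m : ScalarExt f M) : (a * b) • m = a • b • m :=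
  SemigroupAction.mul_smul a b m

namespace RingedPoset

open PrimeSpectrum

variable {X : RingedPoset.{u}} {A : Type u} [CommRing A] {f : ∀ x : X, A →+* X.stalk x}
  {N : SheafModule X} {Γ : Type u} [AddCommGroup Γ] [Module A Γ]
  {p : ∀ x, Γ →ₛₗ[f x] N.stalk x}

/-- The map `𝒪_x ⊗_A Γ → (𝒪_z ⊗_A 𝒪_x) ⊗_{𝒪_z} N_z`. -/
def tensGerm (p : ∀ x, Γ →ₛₗ[f x] N.stalk x) (z x : X) :
    ScalarExt (f x) Γ →ₛₗ[Tens.inr (f z) (f x)] tensStalk f N z x :=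
  ScalarExt.desc (Tens.inr (f z) (f x)) (Tens.inl_comp (f z) (f x)).symm
    (haveI : RingHomCompTriple (f z) (Tens.inl (f z) (f x))
      ((Tens.inl (f z) (f x)).comp (f z)) := ⟨rfl⟩
    (ScalarExt.unit (Tens.inl (f z) (f x)) (N.stalk z)).comp (p z))

theorem tensGerm_unit (z x : X) (γ : Γ) :
    tensGerm p z x (ScalarExt.unit (f x) Γ γ) = ScalarExt.unit _ _ (p z γ) :=
  ScalarExt.desc_unit _ _ _ γ

theorem IsAffineCover.tensTrans_unit (hf : X.IsAffineCover f) {z z' : X} (h : z ≤ z') (x : X)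
    (n : N.stalk z) :
    hf.tensTrans N h x (ScalarExt.unit _ _ n) = ScalarExt.unit _ _ (N.res h n) :=
  ScalarExt.desc_unit _ _ _ n

theorem IsAffineCover.tensRes_unit (hf : X.IsAffineCover f) {z x w : X} (hz : z ≤ w) (hx : x ≤ w)
    (n : N.stalk z) : hf.tensRes N hz hx (ScalarExt.unit _ _ n) = N.res hz n :=
  ScalarExt.desc_unit _ _ _ n

theorem IsAffineCover.res_tensRes (hf : X.IsAffineCover f) {z x w w' : X} (hz : z ≤ w)
    (hx : x ≤ w) (h : w ≤ w') (m : tensStalk f N z x) :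
    N.res h (hf.tensRes N hz hx m) = hf.tensRes N (hz.trans h) (hx.trans h) m := by
  refine ScalarExt.induction_on m (fun s n => ?_) (fun a b ha hb => ?_)
  · rw [LinearMap.map_smulₛₗ, LinearMap.map_smulₛₗ, LinearMap.map_smulₛₗ, hf.tensRes_unit,
      hf.tensRes_unit, N.res_res, ← hf.res_comp_toTens hz hx h]
    rfl
  · simp only [map_add, ha, hb]

/-- The two routes from `𝒪_x ⊗_A Γ` to `N_w`, through the overlap of `z` and `x` and through `N_x`,
agree. This lets questions about `N_x` be decided on overlaps. -/
theorem IsAffineCover.tensRes_tensGerm (hf : X.IsAffineCover f) (hp : IsLimit N fun x => p x)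
    {z x w : X} (hz : z ≤ w) (hx : x ≤ w) (e : ScalarExt (f x) Γ) :
    hf.tensRes N hz hx (tensGerm p z x e) = N.res hx (ScalarExt.lift (p x) e) := by
  refine ScalarExt.induction_on e (fun s γ => ?_) (fun a b ha hb => ?_)
  · rw [LinearMap.map_smulₛₗ, LinearMap.map_smulₛₗ, tensGerm_unit, hf.tensRes_unit, map_smul,
      ScalarExt.lift_unit, LinearMap.map_smulₛₗ, hp.res, hp.res, ← RingHom.comp_apply,
      hf.toTens_comp_inr]
  · simp only [map_add, ha, hb]

/-- Flat base change of the sections of `N` along `A → 𝒪_x`. -/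
theorem IsAffineCover.isLimit_tensGerm (hf : X.IsAffineCover f) (hp : IsLimit N fun x => p x)
    (x : X) :
    (∀ e : ScalarExt (f x) Γ, (∀ z, tensGerm p z x e = 0) → e = 0) ∧
    ∀ m : ∀ z, tensStalk f N z x, (∀ z z' (h : z ≤ z'), hf.tensTrans N h x (m z) = m z') →
      ∃ e : ScalarExt (f x) Γ, ∀ z, tensGerm p z x e = m z := by
  have hsmul : ∀ (z : X) (a b : Tens (f z) (f x)) (m : tensStalk f N z x),
      (a * b) • m = a • b • m := fun z a b m => ScalarExt.mul_smul _ a b m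
  letI := (f x).toAlgebra
  haveI : Module.Flat A (X.stalk x) := hf.flat x
  letI : ∀ z, Module A (N.stalk z) := fun z => Module.compHom _ (f z)
  letI : ∀ z, Module A (tensStalk f N z x) := fun z =>
    Module.compHom _ ((Tens.inl (f z) (f x)).comp (f z))
  letI : ∀ z, Module (X.stalk x) (tensStalk f N z x) := fun z =>
    Module.compHom _ (Tens.inr (f z) (f x))
  haveI : ∀ z, IsScalarTower A (X.stalk x) (tensStalk f N z x) := fun z => ⟨fun a s m => by
    change Tens.inr (f z) (f x) (f x a * s) • m =
      ((Tens.inl (f z) (f x)).comp (f z)) a • Tens.inr (f z) (f x) s • m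
    rw [Tens.inl_comp, map_mul]
    exact hsmul z _ _ m⟩
  let r : ∀ {i j : X}, i ≤ j → N.stalk i →ₗ[A] N.stalk j := fun {i j} h =>
    { toFun := N.res h
      map_add' := map_add _
      map_smul' := fun a n => by
        change N.res h (f i a • n) = f j a • N.res h n
        rw [LinearMap.map_smulₛₗ, ← hf.comp h]
        rfl }
  let r' : ∀ {i j : X}, i ≤ j → tensStalk f N i x →ₗ[X.stalk x] tensStalk f N j x :=
    fun {i j} h =>
    { toFun := hf.tensTrans N h x
      map_add' := map_add _
      map_smul' := fun s m => by
        change hf.tensTrans N h x (Tens.inr (f i) (f x) s • m) =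
          Tens.inr (f j) (f x) s • hf.tensTrans N h x m
        rw [LinearMap.map_smulₛₗ, ← hf.tensTransRing_comp_inr h]
        rfl }
  let v : ∀ i, N.stalk i →ₗ[A] tensStalk f N i x := fun i =>
    { toFun := ScalarExt.unit (Tens.inl (f i) (f x)) (N.stalk i)
      map_add' := map_add _
      map_smul' := fun a n =>
        LinearMap.map_smulₛₗ (ScalarExt.unit (Tens.inl (f i) (f x)) (N.stalk i)) (f i a) n }
  -- `Γ'` is the limit of the base-changed sheaf; it has to be identified with `𝒪_x ⊗_A Γ`.
  let Γ' : Submodule (X.stalk x) (∀ z, tensStalk f N z x) :=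
    { carrier := {m | ∀ i j (h : i ≤ j), r' h (m i) = m j}
      add_mem' := fun ha hb i j h => by
        rw [Pi.add_apply, Pi.add_apply, map_add, ha i j h, hb i j h]
      zero_mem' := fun i j h => map_zero _
      smul_mem' := fun c m hm i j h => by
        rw [Pi.smul_apply, Pi.smul_apply, map_smul, hm i j h] }
  let P : Γ →ₗ[A] ∀ i, N.stalk i :=
    { toFun := fun γ i => p i γ
      map_add' := fun a b => funext fun i => map_add (p i) a b
      map_smul' := fun c a => funext fun i => LinearMap.map_smulₛₗ (p i) c a }
  let U : Γ →ₗ[A] Γ' :=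
    { toFun := fun γ => ⟨fun i => v i (p i γ), fun i j h =>
        (hf.tensTrans_unit h x (p i γ)).trans (congrArg (v j) (hp.res h γ))⟩
      map_add' := fun a b => Subtype.ext (funext fun i =>
        (congrArg (v i) (map_add (p i) a b)).trans (map_add (v i) _ _))
      map_smul' := fun c a => Subtype.ext (funext fun i =>
        (congrArg (v i) (LinearMap.map_smulₛₗ (p i) c a)).trans ((v i).map_smul c (p i a))) }
  have key : IsBaseChange (X.stalk x) U := isBaseChange_limit r r' v
    (fun i => ScalarExt.isBaseChange_pushout (f i) (f x) inferInstance (v i) fun _ => rfl)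
    (fun h n => (hf.tensTrans_unit h x n).symm) P Γ'.subtype
    (fun a b hab => hp.ext fun i => congrFun hab i) Subtype.val_injective
    (fun n => ⟨by
      rintro ⟨γ, rfl⟩ i j h
      exact hp.res h γ, fun hn => by
      obtain ⟨γ, hγ⟩ := hp.exists_of_res n hn
      exact ⟨γ, funext hγ⟩⟩)
    (fun n => ⟨by
      rintro ⟨γ, rfl⟩
      exact γ.2, fun hn => ⟨⟨n, hn⟩, rfl⟩⟩) U fun _ _ => rfl
  -- The components of the abstract isomorphism `𝒪_x ⊗_A Γ ≃ Γ'` are the maps `tensGerm`.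
  have hkey : ∀ (e : ScalarExt (f x) Γ) (z : X), (key.equiv e).1 z = tensGerm p z x e := by
    intro e z
    refine ScalarExt.induction_on e (fun s γ => ?_) (fun a b ha hb => ?_)
    · rw [LinearMap.map_smulₛₗ, tensGerm_unit]
      have h1 : key.equiv (s • ScalarExt.unit (f x) Γ γ) = s • U γ := by
        refine (key.equiv.map_smul s (1 ⊗ₜ γ)).trans ?_
        rw [key.equiv_tmul, one_smul]
      exact congrFun (congrArg Subtype.val h1) z
    · rw [map_add, ← ha, ← hb]
      exact congrFun (congrArg Subtype.val (key.equiv.map_add a b)) z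
  refine ⟨fun e he => ?_, fun m hm => ?_⟩
  · refine key.equiv.injective (Eq.trans ?_ (map_zero key.equiv).symm)
    exact Subtype.ext (funext fun z => (hkey e z).trans (he z))
  · obtain ⟨e, he⟩ := key.equiv.surjective ⟨m, hm⟩
    exact ⟨e, fun z => (hkey e z).symm.trans (by rw [he])⟩

/-- By flatness `𝒪_x ⊗_A Γ` embeds into the product of its overlap modules, and these embed into the
`N_w` with `w ≥ x`, where the image is a restriction from `N_x`. This half of descent does not use
`isLimit_of_isBC`, which depends on it. -/
theorem IsAffineCover.injective_lift (hf : X.IsAffineCover f) (hN : N.IsQuasicoherent)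
    (hp : IsLimit N fun x => p x) (x : X) : Function.Injective (ScalarExt.lift (p x)) := by
  refine (injective_iff_map_eq_zero _).2 fun e he => ?_
  refine (hf.isLimit_tensGerm hp x).1 e fun z => hf.tensStalk_ext hN fun w hz hx => ?_
  rw [hf.tensRes_tensGerm hp, he, map_zero, map_zero]

/-- If the `N_x` are the base changes of an `A`-module `M`, then `M` is the module of sections. -/
theorem IsAffineCover.isLimit_of_isBC (hf : X.IsAffineCover f) {M : Type u} [AddCommGroup M]
    [Module A M] {u : ∀ x, M →ₛₗ[f x] N.stalk x} (hu : ∀ x, IsBC (f x) (u x))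
    (hres : ∀ {x y : X} (h : x ≤ y) (m : M), N.res h (u x m) = u y m) :
    IsLimit N fun x => u x := by
  have hN : N.IsQuasicoherent := fun x y h => IsBC.of_comp (hf.comp h) (hres h) (hu x) (hu y)
  refine ⟨hres, fun {m m'} h => sub_eq_zero.1 (IsBC.eq_zero_of_forall_eq_zero hf.flat hf.cover hu
    fun x => by rw [map_sub, h, sub_self]), fun n hn => ?_⟩
  letI : ∀ z, Module A (N.stalk z) := fun z => Module.compHom _ (f z)
  let Γ : Submodule A (∀ x, N.stalk x) :=
    { carrier := {m | ∀ i j (h : i ≤ j), N.res h (m i) = m j}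
      add_mem' := fun ha hb i j h => by
        rw [Pi.add_apply, Pi.add_apply, map_add, ha i j h, hb i j h]
      zero_mem' := fun i j h => map_zero _
      smul_mem' := fun c m hm i j h => by
        change N.res h (f i c • m i) = f j c • m j
        rw [LinearMap.map_smulₛₗ, hm i j h, ← hf.comp h]
        rfl }
  let p : ∀ x, Γ →ₛₗ[f x] N.stalk x := fun x =>
    { toFun := fun γ => γ.1 x
      map_add' := fun _ _ => rfl
      map_smul' := fun _ _ => rfl }
  have hp : IsLimit N fun x => p x :=
    ⟨fun h γ => γ.2 _ _ h, fun h => Subtype.ext (funext h), fun n hn => ⟨⟨n, hn⟩, fun _ => rfl⟩⟩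
  let U : M →ₗ[A] Γ :=
    { toFun := fun m => ⟨fun x => u x m, fun _ _ h => hres h m⟩
      map_add' := fun a b => Subtype.ext (funext fun x => map_add (u x) a b)
      map_smul' := fun c a => Subtype.ext (funext fun x => LinearMap.map_smulₛₗ (u x) c a) }
  -- Surjectivity of `M → Γ` is checked by showing that each class in the cokernel `Q` vanishes
  -- after every base change `𝒪_x ⊗_A Q`.
  let Q := Γ ⧸ LinearMap.range U
  let π : Γ →ₗ[A] Q := (LinearMap.range U).mkQ
  have hπ : ∀ x, ∀ e : ScalarExt (f x) M, ∃ e' : ScalarExt (f x) Γ,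
      ScalarExt.lift (p x) e' = ScalarExt.lift (u x) e ∧
      ScalarExt.lift ((ScalarExt.unit (f x) Q).comp π) e' = 0 := by
    intro x e
    refine ScalarExt.induction_on e (fun s m => ⟨s • ScalarExt.unit _ _ (U m), ?_, ?_⟩) ?_
    · rw [map_smul, map_smul, ScalarExt.lift_unit, ScalarExt.lift_unit]
      rfl
    · have : π (U m) = 0 := (Submodule.Quotient.mk_eq_zero _).2 ⟨m, rfl⟩
      rw [map_smul, ScalarExt.lift_unit, LinearMap.comp_apply, this, map_zero, smul_zero]
    · rintro a b ⟨a', ha, ha'⟩ ⟨b', hb, hb'⟩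
      exact ⟨a' + b', by rw [map_add, map_add, ha, hb], by rw [map_add, ha', hb', add_zero]⟩
  have hzero : π ⟨n, hn⟩ = 0 := by
    refine IsBC.eq_zero_of_forall_eq_zero hf.flat hf.cover (fun x => IsBC.unit (f x)) fun x => ?_
    obtain ⟨e, he⟩ := (hu x).2 (n x)
    obtain ⟨e', h1, h2⟩ := hπ x e
    -- Both have image `n x` in `N_x`, and `𝒪_x ⊗_A Γ → N_x` is injective; so `1 ⊗ n` comes from
    -- `𝒪_x ⊗_A M` and dies in `𝒪_x ⊗_A Q`.
    have : e' = ScalarExt.unit (f x) Γ ⟨n, hn⟩ := by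
      refine hf.injective_lift hN hp x ?_
      rw [h1, he, ScalarExt.lift_unit]
      rfl
    rw [this, ScalarExt.lift_unit] at h2
    exact h2
  obtain ⟨m, hm⟩ := (Submodule.Quotient.mk_eq_zero _).1 hzero
  exact ⟨m, fun x => congrFun (congrArg Subtype.val hm) x⟩

/-- The stalks of a quasi-coherent module are the base changes of its module of sections. -/
theorem IsAffineCover.isBC_of_isLimit (hf : X.IsAffineCover f) (hN : N.IsQuasicoherent)
    (hp : IsLimit N fun x => p x) (x : X) : IsBC (f x) (p x) := by
  refine ⟨hf.injective_lift hN hp x, fun n => ?_⟩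
  -- On the overlap of `z` and `x` the sheaf comes from a module by construction, so the
  -- restrictions of `n` glue there by the case already proved.
  have hlim : ∀ z, ∃ m : tensStalk f N z x, ∀ (w : X) (hz : z ≤ w) (hx : x ≤ w),
      hf.tensRes N hz hx m = N.res hx n := by
    intro z
    have := (hf.tens z x).isLimit_of_isBC (N := N.restrict {w | z ≤ w ∧ x ≤ w})
      (M := tensStalk f N z x) (u := fun w => hf.tensRes N w.2.1 w.2.2)
      (fun w => hf.isBC_tensRes hN w.2.1 w.2.2) ?_
    · obtain ⟨m, hm⟩ := this.exists_of_res (fun w => N.res w.2.2 n)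
        fun w w' h => N.res_res w.2.2 h n
      exact ⟨m, fun w hz hx => hm ⟨w, hz, hx⟩⟩
    · exact fun {w _} h m => hf.res_tensRes w.2.1 w.2.2 h m
  choose m hm using hlim
  -- The glued elements are compatible in `z`, hence come from `𝒪_x ⊗_A Γ`; evaluating at `z = w =
  -- x` recovers `n`.
  obtain ⟨e, he⟩ := (hf.isLimit_tensGerm hp x).2 m fun z z' h => hf.tensStalk_ext hN
    fun w hz hx => by rw [hf.tensRes_tensTrans, hm, hm]
  refine ⟨e, ?_⟩
  have := hm x x le_rfl le_rfl
  rw [← he, hf.tensRes_tensGerm hp, N.res_refl, N.res_refl] at this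
  exact this

/-! ### Affine covers and `Mod`-affine spaces -/

/-- The structure sheaf as a sheaf of modules. -/
def structureSheaf (X : RingedPoset.{u}) : SheafModule X where
  stalk := X.stalk
  res := fun h => (X.res h).toSemilinearMap
  res_refl := X.res_refl
  res_res := X.res_res

theorem isBC_toSemilinearMap {R S : Type u} [CommRing R] [CommRing S] (f : R →+* S) :
    IsBC f f.toSemilinearMap := by
  refine Function.bijective_iff_has_inverse.2 ⟨fun s => s • ScalarExt.unit f R 1, fun x => ?_,
    fun s => ?_⟩
  · refine ScalarExt.induction_on x (fun s r => ?_) (fun a b ha hb => ?_)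
    · have : ScalarExt.unit f R r = f r • ScalarExt.unit f R 1 := by
        rw [← LinearMap.map_smulₛₗ, smul_eq_mul, mul_one]
      rw [map_smul, ScalarExt.lift_unit, this, smul_smul]
      rfl
    · have e := map_add (ScalarExt.lift f.toSemilinearMap) a b
      change ScalarExt.lift f.toSemilinearMap (a + b) • ScalarExt.unit f R 1 = a + b
      rw [e]
      exact (add_smul _ _ _).trans (congrArg₂ (· + ·) ha hb)
  · beta_reduce
    rw [map_smul, ScalarExt.lift_unit, RingHom.coe_toSemilinearMap, map_one, smul_eq_mul, mul_one]

/-- The map to global sections induced by compatible maps to the stalks. -/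
def IsAffineCover.toSections (hf : X.IsAffineCover f) : A →+* X.sections :=
  RingHom.codRestrict (RingHom.pi f) _ fun a _ _ h => RingHom.congr_fun (hf.comp h) a

/-- Descent for the module `A` itself, whose base changes form the structure sheaf. -/
theorem IsAffineCover.bijective_toSections (hf : X.IsAffineCover f) :
    Function.Bijective hf.toSections := by
  have := hf.isLimit_of_isBC (N := structureSheaf X) (M := A)
    (u := fun x => (f x).toSemilinearMap) (fun x => isBC_toSemilinearMap (f x))
    fun h m => RingHom.congr_fun (hf.comp h) m
  refine ⟨fun a b h => this.ext fun x => congrFun (congrArg Subtype.val h) x, fun s => ?_⟩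
  obtain ⟨a, ha⟩ := this.exists_of_res s.1 s.2
  exact ⟨a, Subtype.ext (funext ha)⟩

theorem IsAffineCover.of_bijective {B : Type u} [CommRing B] (hf : X.IsAffineCover f)
    {g : ∀ x : X, B →+* X.stalk x} {a : A →+* B} (ha : Function.Bijective a)
    (hg : ∀ x, (g x).comp a = f x) : X.IsAffineCover g := by
  have hrange : ∀ (p : PrimeSpectrum B) (x : X),
      comap a p ∈ Set.range (comap (f x)) ↔ p ∈ Set.range (comap (g x)) := by
    intro p x
    rw [← hg x]
    constructor
    · rintro ⟨q, hq⟩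
      exact ⟨q, (RingHom.IsEpic.of_bijective ha).comap_injective
        (by rw [← hq, comap_comp_apply])⟩
    · rintro ⟨q, rfl⟩
      exact ⟨q, by rw [comap_comp_apply]⟩
  refine ⟨fun {x y} h => ?_, fun x => ?_, fun x => ?_, fun p => ?_, fun p x y hx hy => ?_⟩
  · refine RingHom.IsEpic.of_bijective ha _ _ _ ?_
    rw [RingHom.comp_assoc, hg, hg, hf.comp]
  · exact (RingHom.IsEpic.of_bijective ha).flat_of_comp (by rw [hg]; exact hf.flat x)
  · exact RingHom.IsEpic.of_comp (f := a) (by rw [hg]; exact hf.epi x)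
  · simpa only [hrange] using hf.cover (comap a p)
  · rw [← hrange] at hx hy
    simpa only [hrange] using hf.inter _ x y hx hy

/-- After replacing `A` by the isomorphic ring of sections, the unit is bijective by
`isLimit_of_isBC` and the counit by `isBC_of_isLimit`. -/
theorem IsAffineCover.isModAffine (hf : X.IsAffineCover f) : X.IsModAffine := by
  have hs : X.IsAffineCover X.germ := hf.of_bijective hf.bijective_toSections fun _ => rfl
  refine ⟨fun M _ _ => ?_, fun N hN x => ?_⟩
  · have := hs.isLimit_of_isBC (N := SheafModule.pullback X M)
      (u := fun x => ScalarExt.unit (X.germ x) M) (fun x => IsBC.unit _)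
      fun h m => ScalarExt.map_unit (X.res h) (X.res_germ h) m
    refine ⟨fun a b h => this.ext fun x => congrFun (congrArg Subtype.val h) x, fun s => ?_⟩
    obtain ⟨a, ha⟩ := this.exists_of_res s.1 s.2
    exact ⟨a, Subtype.ext (funext ha)⟩
  · exact hs.isBC_of_isLimit (p := N.germ) hN ⟨fun h γ => γ.2 _ _ h,
      fun h => Subtype.ext (funext h), fun n hn => ⟨⟨n, hn⟩, fun _ => rfl⟩⟩ x

end RingedPoset

open PrimeSpectrum

theorem Tens.flat_inl {R A B : Type u} [CommRing R] [CommRing A] [CommRing B] {f : R →+* A}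
    {g : R →+* B} (hg : g.Flat) : (Tens.inl f g).Flat := by
  letI := f.toAlgebra
  letI := g.toAlgebra
  haveI : Module.Flat R B := hg
  exact RingHom.flat_algebraMap_iff.2
    (inferInstance : Module.Flat A (TensorProduct R A B))

namespace RingedPoset

/-! ### Fibered products of schematic spaces -/

section FiberProd

variable {X Y S : RingedPoset.{u}} {f : Hom X S} {g : Hom Y S}

theorem Hom.sharp_comp_res (f : Hom X S) {s : S} {x x' : X} (h : s ≤ f x) (hx : x ≤ x') :
    (f.sharp x').comp (S.res (h.trans (f.mono hx))) =
      (X.res hx).comp ((f.sharp x).comp (S.res h)) := by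
  ext a
  simp only [RingHom.comp_apply]
  rw [f.res_sharp, S.res_res]

/-- Schematicity of `f` concerns primes of `𝒪_{f x}`; injectivity of `Spec 𝒪_{f x} → Spec 𝒪_s`
transports it to primes of `𝒪_s`. -/
theorem Hom.IsSchematic.exists_mem_range_of_le (hf : f.IsSchematic) (hS : S.IsSchematic) {s s' : S}
    {x : X} (h : s ≤ f x) (h' : f x ≤ s') {p : PrimeSpectrum (S.stalk s)}
    (hp : p ∈ Set.range (comap ((f.sharp x).comp (S.res h))))
    (hp' : p ∈ Set.range (comap (S.res (h.trans h')))) :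
    ∃ (x' : X) (hx : x ≤ x'), s' ≤ f x' ∧
      p ∈ Set.range (comap ((f.sharp x').comp (S.res (h.trans (f.mono hx))))) := by
  obtain ⟨q, rfl⟩ := hp
  obtain ⟨r, hr⟩ := hp'
  have e : (S.res h').comp (S.res h) = S.res (h.trans h') := RingHom.ext fun a => S.res_res h h' a
  obtain ⟨x', hx, hs, q', hq'⟩ := hf.exists_mem_range h' ⟨q, rfl⟩
    ⟨r, (hS.isEpic h).comap_injective (by
      rw [← comap_comp_apply, e, hr, comap_comp_apply])⟩
  refine ⟨x', hx, hs, q', ?_⟩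
  rw [f.sharp_comp_res h hx, ← RingHom.comp_assoc, comap_comp_apply, hq', ← comap_comp_apply]

/-- A prime of `𝒪_{S,s}` in the images of `x` and `y` is in the image of a point `(x', y')` of the
fibered product with `x' ≥ x` and `y' ≥ y`. -/
theorem exists_fiberProd_mem_range (hS : S.IsSchematic) (hf : f.IsSchematic) (hg : g.IsSchematic)
    {s : S} {x : X} {y : Y} (hx : s ≤ f x) (hy : s ≤ g y) {p : PrimeSpectrum (S.stalk s)}
    (hpx : p ∈ Set.range (comap ((f.sharp x).comp (S.res hx))))
    (hpy : p ∈ Set.range (comap ((g.sharp y).comp (S.res hy)))) :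
    ∃ (x' : X) (y' : Y) (hx' : x ≤ x') (hy' : y ≤ y'), f x' = g y' ∧
      p ∈ Set.range (comap ((f.sharp x').comp (S.res (hx.trans (f.mono hx'))))) ∧
      p ∈ Set.range (comap ((g.sharp y').comp (S.res (hy.trans (g.mono hy'))))) := by
  have hpx' : p ∈ Set.range (comap (S.res hx)) := by
    obtain ⟨q, rfl⟩ := hpx
    exact ⟨_, (comap_comp_apply _ _ q).symm⟩
  have hpy' : p ∈ Set.range (comap (S.res hy)) := by
    obtain ⟨q, rfl⟩ := hpy
    exact ⟨_, (comap_comp_apply _ _ q).symm⟩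
  -- Schematic morphisms only give `x'` and `y'` with images above a chosen point of `T`. Both
  -- images lie in `T` again, so choosing a maximal point forces them to coincide with it.
  let T : Set S := {s' | f x ≤ s' ∧ g y ≤ s' ∧ ∃ h : s ≤ s', p ∈ Set.range (comap (S.res h))}
  have hT : T.Nonempty := by
    obtain ⟨s', h, h', hs'⟩ := hS.exists_mem_range hx hy hpx' hpy'
    exact ⟨s', h, h', _, hs'⟩
  obtain ⟨m, ⟨hxm, hym, hsm, hm⟩, hmax⟩ := T.toFinite.exists_maximal hT
  obtain ⟨x', hx', hmx, hx''⟩ := hf.exists_mem_range_of_le hS hx hxm hpx hm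
  obtain ⟨y', hy', hmy, hy''⟩ := hg.exists_mem_range_of_le hS hy hym hpy hm
  have e1 : f x' = m := le_antisymm (hmax ⟨hxm.trans hmx, hym.trans hmx, hsm.trans hmx, by
    obtain ⟨q, rfl⟩ := hx''
    exact ⟨_, (comap_comp_apply _ _ q).symm⟩⟩ hmx) hmx
  have e2 : g y' = m := le_antisymm (hmax ⟨hxm.trans hmy, hym.trans hmy, hsm.trans hmy, by
    obtain ⟨q, rfl⟩ := hy''
    exact ⟨_, (comap_comp_apply _ _ q).symm⟩⟩ hmy) hmy
  exact ⟨x', y', hx', hy', e1.trans e2.symm, hx'', hy''⟩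

/-- The map `𝒪_{X,x} → 𝒪_{(x,y)}`. -/
def fiberInl (f : Hom X S) (g : Hom Y S) (z : fiberProd f g) :
    X.stalk z.1.1 →+* (fiberProd f g).stalk z :=
  Tens.inl _ _

/-- The map `𝒪_{Y,y} → 𝒪_{(x,y)}`. -/
def fiberInr (f : Hom X S) (g : Hom Y S) (z : fiberProd f g) :
    Y.stalk z.1.2 →+* (fiberProd f g).stalk z :=
  Tens.inr _ _

theorem res_comp_fiberInl (f : Hom X S) (g : Hom Y S) {z z' : fiberProd f g} (h : z ≤ z')
    (hx : z.1.1 ≤ z'.1.1) :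
    ((fiberProd f g).res h).comp (fiberInl f g z) = (fiberInl f g z').comp (X.res hx) :=
  RingHom.ext fun a => fiberProd_res_inl f g h hx a

theorem res_comp_fiberInr (f : Hom X S) (g : Hom Y S) {z z' : fiberProd f g} (h : z ≤ z')
    (hy : z.1.2 ≤ z'.1.2) :
    ((fiberProd f g).res h).comp (fiberInr f g z) = (fiberInr f g z').comp (Y.res hy) :=
  RingHom.ext fun a => fiberProd_res_inr f g h hy a

/-- The map `𝒪_{S,s} → 𝒪_{(x,y)}` for `s ≤ f x = g y`. -/
def fiberBase (f : Hom X S) (g : Hom Y S) {s : S} (z : fiberProd f g) (h : s ≤ f z.1.1) :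
    S.stalk s →+* (fiberProd f g).stalk z :=
  (fiberInl f g z).comp ((f.sharp z.1.1).comp (S.res h))

theorem fiberBase_eq (f : Hom X S) (g : Hom Y S) {s : S} (z : fiberProd f g) (h : s ≤ f z.1.1) :
    fiberBase f g z h =
      (fiberInr f g z).comp ((g.sharp z.1.2).comp (S.res (h.trans z.2.le))) := by
  refine RingHom.ext fun a => (RingHom.congr_fun (Tens.inl_comp (f.sharp z.1.1)
    ((g.sharp z.1.2).comp (S.res z.2.le))) (S.res h a)).trans ?_
  exact congrArg (fun b => fiberInr f g z (g.sharp z.1.2 b)) (S.res_res h z.2.le a)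

theorem res_comp_fiberBase (f : Hom X S) (g : Hom Y S) {s : S} {z z' : fiberProd f g}
    (h : s ≤ f z.1.1) (hz : z ≤ z') (hx : z.1.1 ≤ z'.1.1) :
    ((fiberProd f g).res hz).comp (fiberBase f g z h) =
      fiberBase f g z' (h.trans (f.mono hx)) := by
  ext a
  refine (fiberProd_res_inl f g hz hx _).trans (congrArg (fiberInl f g z') ?_)
  exact (RingHom.congr_fun (f.sharp_comp_res h hx) a).symm

/-- The lifts to `x` and `y` already agree over `𝒪_{f x}`, by injectivity on spectra, so they glue
to a prime of the tensor product. -/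
theorem mem_range_fiberBase (hS : S.IsSchematic) {s : S} (z : fiberProd f g) (h : s ≤ f z.1.1)
    {p : PrimeSpectrum (S.stalk s)}
    (hp : p ∈ Set.range (comap ((f.sharp z.1.1).comp (S.res h))))
    (hp' : p ∈ Set.range (comap ((g.sharp z.1.2).comp (S.res (h.trans z.2.le))))) :
    p ∈ Set.range (comap (fiberBase f g z h)) := by
  obtain ⟨a, rfl⟩ := hp
  obtain ⟨b, hb⟩ := hp'
  have e : (S.res z.2.le).comp (S.res h) = S.res (h.trans z.2.le) :=
    RingHom.ext fun a => S.res_res h z.2.le a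
  obtain ⟨t, rfl, rfl⟩ := Tens.exists_comap_eq (f.sharp z.1.1)
    ((g.sharp z.1.2).comp (S.res z.2.le)) a b ((hS.isEpic h).comap_injective (by
      rw [← comap_comp_apply, ← comap_comp_apply, RingHom.comp_assoc, e, hb]))
  exact ⟨t, comap_comp_apply _ _ t⟩

theorem isEpic_fiberBase (hS : S.IsSchematic) (hf : ∀ x, (f.sharp x).IsEpic)
    (hg : ∀ y, (g.sharp y).IsEpic) {s : S} (z : fiberProd f g) (h : s ≤ f z.1.1) :
    (fiberBase f g z h).IsEpic :=
  (hS.isEpic h).comp ((hf _).inl_comp ((hS.isEpic _).comp (hg _)))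

theorem flat_fiberBase (hS : S.IsSchematic) (hf : f.IsFlat) (hg : g.IsFlat) {s : S}
    (z : fiberProd f g) (h : s ≤ f z.1.1) : (fiberBase f g z h).Flat :=
  ((hS.flat h).comp (hf _)).comp (Tens.flat_inl ((hS.flat _).comp (hg _)))

theorem isEpic_fiberProd_res (hS : S.IsSchematic) (hf : ∀ x, (f.sharp x).IsEpic)
    (hg : ∀ y, (g.sharp y).IsEpic) {z z' : fiberProd f g} (h : z ≤ z') :
    ((fiberProd f g).res h).IsEpic := by
  refine RingHom.IsEpic.of_comp (f := fiberBase f g z le_rfl) ?_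
  rw [res_comp_fiberBase f g le_rfl h h.1]
  exact isEpic_fiberBase hS hf hg z' _

/-- Fibered products of schematic spaces along flat monomorphisms are schematic. -/
theorem isSchematic_fiberProd (hX : X.IsSchematic) (hY : Y.IsSchematic) (hS : S.IsSchematic)
    (hf : f.IsSchematic) (hg : g.IsSchematic) (hf' : f.IsFlat) (hg' : g.IsFlat)
    (hfe : ∀ x, (f.sharp x).IsEpic) (hge : ∀ y, (g.sharp y).IsEpic) :
    (fiberProd f g).IsSchematic := by
  refine isSchematic_of_exists_mem_range (fun z z' h => ?_)
    (fun z z' h => isEpic_fiberProd_res hS hfe hge h) fun t z₁ z₂ h₁ h₂ p hp₁ hp₂ => ?_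
  · refine (isEpic_fiberBase hS hfe hge z le_rfl).flat_of_comp ?_
    rw [res_comp_fiberBase f g le_rfl h h.1]
    exact flat_fiberBase hS hf' hg' z' _
  · have hl : ∀ (z : fiberProd f g) (h : t ≤ z),
        p ∈ Set.range (comap ((fiberProd f g).res h)) →
        comap (fiberInl f g t) p ∈ Set.range (comap (X.res (show t.1 ≤ z.1 from h).1)) := by
      rintro z h ⟨q, rfl⟩
      exact ⟨comap (fiberInl f g z) q, by
        rw [← comap_comp_apply, ← res_comp_fiberInl f g h, comap_comp_apply]⟩
    have hr : ∀ (z : fiberProd f g) (h : t ≤ z),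
        p ∈ Set.range (comap ((fiberProd f g).res h)) →
        comap (fiberInr f g t) p ∈ Set.range (comap (Y.res (show t.1 ≤ z.1 from h).2)) := by
      rintro z h ⟨q, rfl⟩
      exact ⟨comap (fiberInr f g z) q, by
        rw [← comap_comp_apply, ← res_comp_fiberInr f g h, comap_comp_apply]⟩
    obtain ⟨x, hx₁, hx₂, qx, hx⟩ := hX.exists_mem_range _ _ (hl z₁ h₁ hp₁) (hl z₂ h₂ hp₂)
    obtain ⟨y, hy₁, hy₂, qy, hy⟩ := hY.exists_mem_range _ _ (hr z₁ h₁ hp₁) (hr z₂ h₂ hp₂)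
    have htx : t.1.1 ≤ x := (show t.1 ≤ z₁.1 from h₁).1.trans hx₁
    have hty : t.1.2 ≤ y := (show t.1 ≤ z₁.1 from h₁).2.trans hy₁
    -- The points `x` and `y`, found separately in the two factors, need not have the same image in
    -- `S`. Passing to `p₀` in `𝒪_{S,s}` makes it possible to enlarge them to a point of the fibered
    -- product, and injectivity on spectra brings the result back to `p`.
    let p₀ := comap (fiberBase f g t le_rfl) p
    obtain ⟨x', y', hx', hy', e, hpx, hpy⟩ := exists_fiberProd_mem_range hS hf hg (p := p₀)
      (f.mono htx) (t.2.le.trans (g.mono hty)) ⟨qx, by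
        rw [f.sharp_comp_res le_rfl htx, comap_comp_apply, hx, ← comap_comp_apply]
        rfl⟩ ⟨qy, by
        rw [g.sharp_comp_res t.2.le hty, comap_comp_apply, hy, ← comap_comp_apply]
        exact congrArg (fun k => comap k p) (fiberBase_eq f g t le_rfl).symm⟩
    let z : fiberProd f g := ⟨(x', y'), e⟩
    have htz : t ≤ z := ⟨htx.trans hx', hty.trans hy'⟩
    obtain ⟨q, hq⟩ := mem_range_fiberBase hS z (f.mono (htx.trans hx')) hpx hpy
    refine ⟨z, ⟨hx₁.trans hx', hy₁.trans hy'⟩, ⟨hx₂.trans hx', hy₂.trans hy'⟩, q, ?_⟩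
    refine (isEpic_fiberBase hS hfe hge t le_rfl).comap_injective ?_
    rw [← comap_comp_apply, res_comp_fiberBase f g le_rfl htz htz.1]
    exact hq

end FiberProd

/-! ### Points of qc-isomorphisms -/

/-- If `p` is missed by every stalk, then `κ(p) ⊗ 𝒪_x = 0` for all `x`, so the injective unit `κ(p)
→ π_* π^* κ(p)` is zero. -/
theorem IsModAffine.exists_mem_range {X : RingedPoset.{u}} (hX : X.IsModAffine)
    (p : PrimeSpectrum X.sections) : ∃ x, p ∈ Set.range (comap (X.germ x)) := by
  by_contra! H
  have hz : SheafModule.unit X p.asIdeal.ResidueField 1 = 0 := by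
    refine Subtype.ext (funext fun x => ?_)
    letI := (X.germ x).toAlgebra
    have hs : Subsingleton (TensorProduct X.sections p.asIdeal.ResidueField (X.stalk x)) :=
      not_nontrivial_iff_subsingleton.1 fun h =>
        H x ((PrimeSpectrum.nontrivial_iff_mem_rangeComap p).1 h)
    have hs' : Subsingleton (TensorProduct X.sections (X.stalk x) p.asIdeal.ResidueField) :=
      (TensorProduct.comm _ _ _).toEquiv.subsingleton
    exact hs'.elim _ _
  exact one_ne_zero ((hX.1 p.asIdeal.ResidueField).1 (hz.trans (map_zero _).symm))

theorem Hom.IsQCIso.exists_mem_range {X Y : RingedPoset.{u}} {f : Hom X Y} (hf : f.IsQCIso) (y : Y)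
    (p : PrimeSpectrum (Y.stalk y)) :
    ∃ (x : X) (h : y ≤ f x), p ∈ Set.range (comap ((f.sharp x).comp (Y.res h))) := by
  let e := RingEquiv.ofBijective _ (hf.2 y)
  obtain ⟨x, q, hq⟩ := (hf.1 y).exists_mem_range (comap e.symm.toRingHom p)
  refine ⟨x.1, x.2, q, ?_⟩
  have h1 : comap (f.toPushforward y) (comap e.symm.toRingHom p) = p := by
    rw [← comap_comp_apply]
    have : e.symm.toRingHom.comp (f.toPushforward y) = RingHom.id _ :=
      RingHom.ext fun a => e.symm_apply_apply a
    rw [this, comap_id]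
  rw [← h1, ← hq, ← comap_comp_apply]
  rfl

end RingedPoset

open RingedPoset PrimeSpectrum

namespace RingedDatum

variable {D : RingedDatum.{u}}

/-! ### Schematic cylinders -/

/-- The point of the cylinder given by a point of `𝒳(p)`. -/
def cylMk {p : D.index} (x : D.obj p) : D.cyl := (⟨p, x⟩ : D.CylPoint)

theorem flat_cyl_res (hD : D.IsSchematic) (hflat : ∀ (p q : D.index) (h : p ≤ q), (D.map h).IsFlat)
    {a b : D.cyl} (h : a ≤ b) : (D.cyl.res h).Flat :=
  ((hD.1 a.base).flat (CylPoint.pt_le h)).comp (hflat _ _ (CylPoint.base_le h) b.pt)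

theorem isEpic_cyl_res (hD : D.IsSchematic)
    (hepi : ∀ (p q : D.index) (h : p ≤ q) (x : D.obj q), ((D.map h).sharp x).IsEpic)
    {a b : D.cyl} (h : a ≤ b) : (D.cyl.res h).IsEpic :=
  ((hD.1 a.base).isEpic (CylPoint.pt_le h)).comp (hepi _ _ (CylPoint.base_le h) b.pt)

/-- The point above `x` and `y` supplied by the full cylinder has its index above that of `x`, hence
in `U`. -/
theorem isSchematic_cyl_restrict (hD : D.cyl.IsSchematic) {U : Set D.index} (hU : IsUpperSet U) :
    (D.restrict U).cyl.IsSchematic := by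
  let ι : (D.restrict U).cyl → D.cyl := fun a => (⟨a.base.1, a.pt⟩ : D.CylPoint)
  refine isSchematic_of_exists_mem_range (fun a b h => hD.flat (x := ι a) (y := ι b) h)
    (fun a b h => hD.isEpic (x := ι a) (y := ι b) h) fun t x y hx hy p hp hp' => ?_
  obtain ⟨z, hxz, hyz, h⟩ := hD.exists_mem_range (t := ι t) (x := ι x) (y := ι y) hx hy hp hp'
  exact ⟨⟨⟨z.base, hU (CylPoint.base_le hxz) x.base.2⟩, z.pt⟩, hxz, hyz, h⟩

/-! ### The morphisms `π^t_{pq}` -/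

section Pi

variable {t p q : D.index} (hp : t ≤ p) (hq : t ≤ q)

/-- A point of `Cyl(U)` as a point of the cylinder. -/
def cylPt {U : Set D.index} (w : (D.restrict U).cyl) : D.cyl :=
  (⟨w.base.1, w.pt⟩ : D.CylPoint)

variable {hp hq} {z : fiberProd (D.map hp) (D.map hq)}
  {w : (D.restrict (Set.Ici p ∩ Set.Ici q)).cyl}

/-- This identifies the preimage of `U_z` under `π` with the common upper bounds in the cylinder
that occur in the schematic condition. -/
theorem le_cylPi_iff : z ≤ D.cylPi hp hq w ↔
    cylMk z.1.1 ≤ cylPt w ∧ cylMk z.1.2 ≤ cylPt w :=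
  ⟨fun h => ⟨⟨w.base.2.1, h.1⟩, ⟨w.base.2.2, h.2⟩⟩, fun h => ⟨h.1.2, h.2.2⟩⟩

/-- The map `𝒪_z → 𝒪_w` for `z ≤ π w`. -/
def cylPiRes (h : z ≤ D.cylPi hp hq w) :
    (fiberProd (D.map hp) (D.map hq)).stalk z →+* D.cyl.stalk (cylPt w) :=
  ((D.cylPi hp hq).sharp w).comp ((fiberProd (D.map hp) (D.map hq)).res h)

theorem base_le_cylPt {s : D.obj t} (hs : s ≤ D.map hp z.1.1) (h : z ≤ D.cylPi hp hq w) :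
    cylMk s ≤ cylPt w :=
  le_trans (b := cylMk z.1.1) ⟨hp, hs⟩ (le_cylPi_iff.1 h).1

/-- The map `𝒪_s → 𝒪_z` for `s ≤ f x = g y`. -/
def cylBase (z : fiberProd (D.map hp) (D.map hq)) {s : D.obj t} (hs : s ≤ D.map hp z.1.1) :
    D.cyl.stalk (cylMk s) →+* (fiberProd (D.map hp) (D.map hq)).stalk z :=
  fiberBase (D.map hp) (D.map hq) z hs

theorem cylPiRes_comp_cylBase {s : D.obj t} (hs : s ≤ D.map hp z.1.1)
    (h : z ≤ D.cylPi hp hq w) :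
    (cylPiRes h).comp (cylBase z hs) =
      D.cyl.res (base_le_cylPt hs h) := by
  ext a
  have hpw : cylMk z.1.1 ≤ cylPt w := (le_cylPi_iff.1 h).1
  have hst : cylMk s ≤ cylMk z.1.1 := ⟨hp, hs⟩
  refine Eq.trans ?_ (D.cyl.res_res (x := cylMk s) (y := cylMk z.1.1)
    (z := cylPt w) hst hpw a)
  have e1 := fiberProd_res_inl (D.map hp) (D.map hq) h h.1 ((D.map hp).sharp z.1.1
    ((D.obj t).res hs a))
  refine (congrArg ((D.cylPi hp hq).sharp w) e1).trans ?_
  exact Tens.lift_inl _ _ (fiberLift_aux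
    ((D.cylIncl Set.inter_subset_left).comp (D.cylProj p))
    ((D.cylIncl Set.inter_subset_right).comp (D.cylProj q))
    ((D.cylProj_comp_map hp _).trans (D.cylProj_comp_map hq _).symm) w) _

variable (hD : D.IsSchematic)
  (hepi : ∀ (p q : D.index) (h : p ≤ q) (x : D.obj q), ((D.map h).sharp x).IsEpic)

include hD hepi in
theorem isEpic_cylBase {s : D.obj t} (hs : s ≤ D.map hp z.1.1) : (cylBase z hs).IsEpic :=
  isEpic_fiberBase (hD.1 t) (hepi _ _ hp) (hepi _ _ hq) z hs

include hD hepi in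
-- Since `𝒪_s → 𝒪_z` is an epimorphism, membership in the image of `Spec 𝒪_w` can be tested in `Spec
-- 𝒪_s`, where the condition on the cylinder applies.
theorem mem_range_cylPiRes_iff (h : z ≤ D.cylPi hp hq w)
    (P : PrimeSpectrum ((fiberProd (D.map hp) (D.map hq)).stalk z)) :
    P ∈ Set.range (comap (cylPiRes h)) ↔
      comap (cylBase z le_rfl) P ∈
        Set.range (comap (D.cyl.res (base_le_cylPt le_rfl h))) := by
  constructor
  · rintro ⟨Q, rfl⟩
    exact ⟨Q, by rw [← cylPiRes_comp_cylBase le_rfl h, comap_comp_apply]⟩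
  · rintro ⟨Q, hQ⟩
    refine ⟨Q, (isEpic_cylBase hD hepi le_rfl).comap_injective ?_⟩
    rw [← hQ, ← cylPiRes_comp_cylBase le_rfl h, comap_comp_apply]

/-- The image in `Spec 𝒪_s` of a prime of `𝒪_{(x,y)}` lies in the images of `x` and of `y`. -/
theorem comap_cylBase_mem_range {s : D.obj t} (hs : s ≤ D.map hp z.1.1)
    (P : PrimeSpectrum ((fiberProd (D.map hp) (D.map hq)).stalk z)) :
    comap (cylBase z hs) P ∈ Set.range (comap
      (D.cyl.res (x := cylMk s) (y := cylMk z.1.1) ⟨hp, hs⟩)) ∧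
    comap (cylBase z hs) P ∈ Set.range (comap
      (D.cyl.res (x := cylMk s) (y := cylMk z.1.2) ⟨hq, hs.trans z.2.le⟩)) := by
  refine ⟨⟨comap (fiberInl _ _ z) P, (comap_comp_apply _ _ P).symm⟩,
    ⟨comap (fiberInr _ _ z) P, (comap_comp_apply _ _ P).symm.trans ?_⟩⟩
  exact congrArg (fun k => comap k P) (fiberBase_eq (D.map hp) (D.map hq) z hs).symm

theorem exists_cylPt_eq {v : D.cyl} (h : cylMk z.1.1 ≤ v) (h' : cylMk z.1.2 ≤ v) :
    ∃ w : (D.restrict (Set.Ici p ∩ Set.Ici q)).cyl, z ≤ D.cylPi hp hq w ∧ cylPt w = v :=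
  ⟨⟨⟨v.base, CylPoint.base_le h, CylPoint.base_le h'⟩, v.pt⟩, le_cylPi_iff.2 ⟨h, h'⟩, rfl⟩

include hD hepi in
-- Both covering conditions are the schematic condition over `s`, the common image of `x` and `y`:
-- the pair `x, y` gives the cover and a pair `w, w'` gives the overlaps. Flatness and epimorphy
-- follow by cancelling the epimorphism `𝒪_s → 𝒪_z`.
theorem isAffineCover_cylPiRes
    (hflat : ∀ (p q : D.index) (h : p ≤ q), (D.map h).IsFlat) (hC : D.cyl.IsSchematic)
    (z : fiberProd (D.map hp) (D.map hq)) :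
    ((D.restrict (Set.Ici p ∩ Set.Ici q)).cyl.restrict {w | z ≤ D.cylPi hp hq w}).IsAffineCover
      (fun w => cylPiRes w.2) := by
  have hb := isEpic_cylBase hD hepi (z := z) le_rfl
  refine ⟨fun {w w'} h => ?_, fun w => hb.flat_of_comp ?_,
    fun w => RingHom.IsEpic.of_comp (f := cylBase z le_rfl) ?_,
    fun P => ?_, fun P w w' hw hw' => ?_⟩
  · ext a
    refine ((D.cylPi hp hq).res_sharp h _).trans (congrArg ((D.cylPi hp hq).sharp w'.1) ?_)
    exact (fiberProd (D.map hp) (D.map hq)).res_res w.2 _ a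
  · exact (congrArg RingHom.Flat (cylPiRes_comp_cylBase le_rfl w.2)).mpr
      (flat_cyl_res hD hflat _)
  · exact (congrArg RingHom.IsEpic (cylPiRes_comp_cylBase le_rfl w.2)).mpr
      (isEpic_cyl_res hD hepi _)
  · obtain ⟨h1, h2⟩ := comap_cylBase_mem_range le_rfl P
    obtain ⟨v, hv, hv', hP⟩ := hC.exists_mem_range _ _ h1 h2
    obtain ⟨w, hw, rfl⟩ := exists_cylPt_eq hv hv'
    exact ⟨⟨w, hw⟩, (mem_range_cylPiRes_iff hD hepi hw P).2 hP⟩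
  · obtain ⟨v, hv, hv', hP⟩ := hC.exists_mem_range _ _
      ((mem_range_cylPiRes_iff hD hepi w.2 P).1 hw) ((mem_range_cylPiRes_iff hD hepi w'.2 P).1 hw')
    obtain ⟨k, hk, rfl⟩ := exists_cylPt_eq ((le_cylPi_iff.1 w.2).1.trans hv)
      ((le_cylPi_iff.1 w.2).2.trans hv)
    exact ⟨⟨k, hk⟩, hv, hv', (mem_range_cylPiRes_iff hD hepi hk P).2 hP⟩

include hD hepi in
theorem isQCIso_cylPi (hflat : ∀ (p q : D.index) (h : p ≤ q), (D.map h).IsFlat)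
    (hC : D.cyl.IsSchematic) : (D.cylPi hp hq).IsQCIso :=
  ⟨fun z => (isAffineCover_cylPiRes hD hepi hflat hC z).isModAffine,
    fun z => (isAffineCover_cylPiRes hD hepi hflat hC z).bijective_toSections⟩

include hD hepi in
theorem isSchematic_cylPi (hC : D.cyl.IsSchematic) : (D.cylPi hp hq).IsSchematic := by
  refine Hom.isSchematic_of_exists_mem_range (fun w => ?_) (fun z z' h =>
    isEpic_fiberProd_res (hD.1 t) (hepi _ _ hp) (hepi _ _ hq) h) fun w z' h P hP hP' => ?_
  · refine RingHom.IsEpic.of_comp (f := ((fiberProd (D.map hp) (D.map hq)).res le_rfl).comp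
      (cylBase (D.cylPi hp hq w) le_rfl)) ?_
    exact (congrArg RingHom.IsEpic (cylPiRes_comp_cylBase le_rfl le_rfl)).mpr
      (isEpic_cyl_res hD hepi _)
  · have hw := (mem_range_cylPiRes_iff hD hepi (z := D.cylPi hp hq w) (w := w) le_rfl P).1 (by
      obtain ⟨Q, rfl⟩ := hP
      refine ⟨Q, congrArg (fun k => comap k Q) ?_⟩
      exact RingHom.ext fun a => congrArg ((D.cylPi hp hq).sharp w)
        ((fiberProd (D.map hp) (D.map hq)).res_refl _ a))
    obtain ⟨Q, rfl⟩ := hP'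
    have hs := (D.map hp).mono h.1
    have e : comap (cylBase z' hs) Q = comap (cylBase (D.cylPi hp hq w) le_rfl)
        (comap ((fiberProd (D.map hp) (D.map hq)).res h) Q) := by
      rw [← comap_comp_apply]
      exact congrArg (fun k => comap k Q)
        (res_comp_fiberBase (D.map hp) (D.map hq) le_rfl h h.1).symm
    obtain ⟨hx, hy⟩ := comap_cylBase_mem_range hs Q
    rw [e] at hx hy
    -- A point above `w` and `z' = (x', y')` must dominate three points of the cylinder, so the
    -- schematic condition is used twice.
    obtain ⟨v, hwv, hxv, hv⟩ := hC.exists_mem_range _ _ hw hx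
    obtain ⟨v', hvv', hyv', hv'⟩ := hC.exists_mem_range _ _ hv hy
    obtain ⟨k, hk, rfl⟩ := exists_cylPt_eq (hxv.trans hvv') hyv'
    have hwk : w ≤ k := hwv.trans hvv'
    obtain ⟨R, hR⟩ := (mem_range_cylPiRes_iff hD hepi ((D.cylPi hp hq).mono hwk) _).2 hv'
    refine ⟨k, hwk, hk, R, Eq.trans (congrArg (fun k => comap k R) ?_) hR⟩
    exact RingHom.ext fun a => (D.cylPi hp hq).res_sharp hwk a

include hD hepi in
theorem isSchematic_cyl_of_isQCIso (hflat : ∀ (p q : D.index) (h : p ≤ q), (D.map h).IsFlat)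
    (H : ∀ (t p q : D.index) (hp : t ≤ p) (hq : t ≤ q), (D.cylPi hp hq).IsQCIso) :
    D.cyl.IsSchematic := by
  refine isSchematic_of_exists_mem_range (fun a b h => flat_cyl_res hD hflat h)
    (fun a b h => isEpic_cyl_res hD hepi h) ?_
  suffices key : ∀ {t p q : D.index} (s : D.obj t) (x : D.obj p) (y : D.obj q)
      (hx : cylMk s ≤ cylMk x) (hy : cylMk s ≤ cylMk y)
      (P : PrimeSpectrum (D.cyl.stalk (cylMk s))),
      P ∈ Set.range (comap (D.cyl.res hx)) → P ∈ Set.range (comap (D.cyl.res hy)) →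
      ∃ (v : D.cyl) (hv : cylMk x ≤ v) (_ : cylMk y ≤ v),
        P ∈ Set.range (comap (D.cyl.res (hx.trans hv))) from
    fun t x y => key t.pt x.pt y.pt
  rintro t p q s x y ⟨hp, hx⟩ ⟨hq, hy⟩ P hPx hPy
  -- The points `x` and `y` need not form a point of the fibered product, so they are first enlarged
  -- to one whose stalk still sees `P`; the qc-isomorphism then supplies the cylinder point above
  -- it.
  obtain ⟨x', y', hx', hy', e, hPx', hPy'⟩ := exists_fiberProd_mem_range (hD.1 t)
    (hD.2 _ _ hp) (hD.2 _ _ hq) hx hy hPx hPy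
  let z : fiberProd (D.map hp) (D.map hq) := ⟨(x', y'), e⟩
  obtain ⟨Q, hQ⟩ := mem_range_fiberBase (hD.1 t) z _ hPx' hPy'
  obtain ⟨w, hw, R, hR⟩ := (H t p q hp hq).exists_mem_range z Q
  obtain ⟨h1, h2⟩ := le_cylPi_iff.1 hw
  refine ⟨cylPt w, le_trans (b := cylMk x')
    ⟨le_rfl, hx'.trans (D.map_refl_apply _ _).ge⟩ h1, le_trans (b := cylMk y')
    ⟨le_rfl, hy'.trans (D.map_refl_apply _ _).ge⟩ h2, R, ?_⟩
  refine Eq.trans ?_ hQ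
  refine Eq.trans ?_ (congrArg (comap (cylBase z (hx.trans ((D.map hp).mono hx')))) hR)
  refine Eq.trans ?_ (comap_comp_apply _ (cylPiRes hw) R)
  exact congrArg (fun k => comap k R)
    (cylPiRes_comp_cylBase (hx.trans ((D.map hp).mono hx')) hw).symm

end Pi

end RingedDatum

/-! ### The theorem -/

theorem mainTheorem6 (D : RingedDatum.{u}) (hD : D.IsSchematic)
    (hflat : ∀ (p q : D.index) (h : p ≤ q), (D.map h).IsFlatImmersion) :
    (D.cyl.IsSchematic ↔
      ∀ (t p q : D.index) (hp : t ≤ p) (hq : t ≤ q), (D.cylPi hp hq).IsQCIso) ∧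
    (D.cyl.IsSchematic →
      ∀ (t p q : D.index) (hp : t ≤ p) (hq : t ≤ q),
        (D.restrict (Set.Ici p ∩ Set.Ici q)).cyl.IsSchematic ∧
        (RingedPoset.fiberProd (D.map hp) (D.map hq)).IsSchematic ∧
        (D.cylPi hp hq).IsSchematic) := by
  have hepi : ∀ (p q : D.index) (h : p ≤ q) (x : D.obj q), ((D.map h).sharp x).IsEpic :=
    fun p q h x => (hflat p q h).isEpic x
  have hfl : ∀ (p q : D.index) (h : p ≤ q), (D.map h).IsFlat := fun p q h => (hflat p q h).1
  refine ⟨⟨fun hC t p q hp hq => RingedDatum.isQCIso_cylPi hD hepi hfl hC,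
    RingedDatum.isSchematic_cyl_of_isQCIso hD hepi hfl⟩, fun hC t p q hp hq => ⟨?_, ?_, ?_⟩⟩
  · exact RingedDatum.isSchematic_cyl_restrict hC ((isUpperSet_Ici p).inter (isUpperSet_Ici q))
  · exact isSchematic_fiberProd (hD.1 p) (hD.1 q) (hD.1 t) (hD.2 _ _ hp) (hD.2 _ _ hq)
      (hfl _ _ hp) (hfl _ _ hq) (hepi _ _ hp) (hepi _ _ hq)
  · exact RingedDatum.isSchematic_cylPi hD hepi hC
end
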